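/- Let $X, X_1, X_2, \dots$ be independent identically distributed real random variables with mean $0$ and variance $\sigma^2$ ($\sigma\ge 0$), let $\phi(s)=\mathbb{E}(e^{isX})$ and $S_n=X_1+\dots+X_n$. Write $\mathfrak{n}(z)=\frac{1}{\sqrt{2\pi}}e^{-z^2/2}$ and $\mathfrak{N}(z)=\int_{-\infty}^z\mathfrak{n}(y)\,dy$. The order $r$ Edgeworth series of $S_n$ is $$\mathcal{E}_r(z)=\mathcal{E}_{r,n}(z)=\mathfrak{N}(z)+\mathfrak{n}(z)\sum_{k=1}^r\frac{P_k(z)}{n^{k/2}},$$ where $P_1,\dots,P_r$ are real polynomials, not depending on $n$, such that for every $t\in\mathbb{R}$ $$\phi\left(\frac{t}{\sigma\sqrt n}\right)^n-\int_{-\infty}^{\infty}e^{itz}\,d\mathcal{E}_{r,n}(z)=o(n^{-r/2})\qquad(n\to\infty).$$ Let $d\ge 1$ be an integer. (1) Suppose that $\mathbb{E}|X|^{d+2}<\infty$ and that there are $K>0$ and $\gamma\in\mathbb{R}$ such that $$|\phi(s)|\le 1-\frac{K}{|s|^{\gamma}}\qquad\text{for all } |s|>1.$$ Then for every real $R<\frac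 d2$ with $\left(R-\frac12\right)\gamma<1$, the order $d-1$ Edgeworth series exists and $$\lim_{n\to\infty}n^R\left[\mathbb{P}\left(\frac{S_n}{\sigma\sqrt n}\le z\right)-\mathcal{E}_{d-1}(z)\right]=0\qquad\text{uniformly in } z\in\mathbb{R}.\tag{$*$}$$ (2) Suppose that $X$ takes the values $a_1,\dots,a_{d+1}$ with probabilities $p_1,\dots,p_{d+1}>0$, and put $d(s)=\max_{2\le j\le d+1}\operatorname{dist}\big((a_j-a_1)s,\,2\pi\mathbb{Z}\big)$. Then there is $c>0$ such that $|\phi(s)|\le 1-c\,d(s)^2$ for all $s\in\mathbb{R}$. If moreover $\mathbf{a}=(a_1,\dots,a_{d+1})$ is $\beta$-Diophantine, that is, there is $K>0$ with $d(s)\ge K|s|^{-\beta}$ for all $|s|>1$, then for every real $R$ with $\left(R-\frac12\right)\beta<\frac12$ the order $d-1$ Edgeworth series exists and $(*)$ holds. -/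

import Mathlib

open MeasureTheory ProbabilityTheory Filter Topology

noncomputable section

/-- The standard normal distribution function. -/
def normalCDF (z : ℝ) : ℝ := ∫ y in Set.Iic z, gaussianPDFReal 0 1 y

/-- The expression `𝔑(z) + 𝔫(z) ∑_{k=1}^r P_k(z) / n^{k/2}` attached to a sequence of
polynomials `P_1, P_2, …` (the value `P 0` is not used). -/
def edgeworthSeries (P : ℕ → Polynomial ℝ) (r n : ℕ) (z : ℝ) : ℝ :=
  normalCDF z + gaussianPDFReal 0 1 z *
    ∑ k ∈ Finset.Icc 1 r, (P k).eval z / (n : ℝ) ^ ((k : ℝ) / 2)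

/-- The Fourier (Fourier-Stieltjes) transform `∫ e^{itz} dE(z)` of a function `E` of the type of a
distribution function; here `E` is always smooth, so `dE(z) = E'(z) dz`. -/
def fourierStieltjes (E : ℝ → ℝ) (t : ℝ) : ℂ :=
  ∫ z : ℝ, Complex.exp ((t * z : ℝ) * Complex.I) * ((deriv E z : ℝ) : ℂ)

/-- `P_1, …, P_r` are the polynomials of the order `r` Edgeworth series of the sums of independent
random variables with characteristic function `φ` and standard deviation `σ`: for every `t`,
`φ(t / (σ √n))^n - Ê_r(t) = o(n^{-r/2})` as `n → ∞`. -/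
def IsEdgeworthPolynomials (φ : ℝ → ℂ) (σ : ℝ) (r : ℕ) (P : ℕ → Polynomial ℝ) : Prop :=
  ∀ t : ℝ, Tendsto
    (fun n : ℕ => (((n : ℝ) ^ ((r : ℝ) / 2) : ℝ) : ℂ) *
      (φ (t / (σ * √(n : ℝ))) ^ n - fourierStieltjes (edgeworthSeries P r n) t))
    atTop (𝓝 0)

/-- `d(s) = max_{j ≥ 2} dist((a_j - a_1) s, 2πℤ)` for `d + 1` real numbers `a_1, …, a_{d+1}`
(numbered here from `0` to `d`). -/
def dioDist {d : ℕ} (a : Fin (d + 1) → ℝ) (s : ℝ) : ℝ :=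
  ⨆ j : Fin d, Metric.infDist ((a j.succ - a 0) * s) (Set.range fun m : ℤ => 2 * Real.pi * m)

/-- `a` is `β`-Diophantine: there is `K > 0` with `d(s) ≥ K / |s|^β` whenever `|s| > 1`. -/
def IsDiophantine {d : ℕ} (a : Fin (d + 1) → ℝ) (β : ℝ) : Prop :=
  ∃ K : ℝ, 0 < K ∧ ∀ s : ℝ, 1 < |s| → K / |s| ^ β ≤ dioDist a s

/-- The order `r` Edgeworth series (which exists) of the sums `S_n = X_0 + … + X_{n-1}`
approximates the distribution function of `S_n / (σ √n)` with an error `o(n^{-R})`,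
uniformly on the real line. -/
def EdgeworthApprox {Ω : Type*} [MeasurableSpace Ω] (μ : Measure Ω) (X : ℕ → Ω → ℝ)
    (σ : ℝ) (r : ℕ) (R : ℝ) : Prop :=
  (∃ P : ℕ → Polynomial ℝ, IsEdgeworthPolynomials (charFun (μ.map (X 0))) σ r P) ∧
  ∀ P : ℕ → Polynomial ℝ, IsEdgeworthPolynomials (charFun (μ.map (X 0))) σ r P →
    TendstoUniformly
      (fun (n : ℕ) (z : ℝ) => (n : ℝ) ^ R *
        (μ.real {ω | (∑ i ∈ Finset.range n, X i ω) / (σ * √(n : ℝ)) ≤ z}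
          - edgeworthSeries P r n z))
      (fun _ => 0) atTop

end

/-!
The proof is Fourier-analytic.

*Fourier side.* After normalising the variance, let `ψ` be the characteristic function and put
`x = n^{-1/2}`, `τ = i t`, `u = t x`. Then `ψ(u) exp (u² / 2) = 1 + (i u)³ V(i u) + O(|u|^{d+2})`
with a real polynomial `V` (`exists_charFun_mul_exp_expansion`). The `n`-th power of the right-hand
side is expanded by the binomial theorem; since `n x² = 1`, the `k`-th term is a polynomial in `x` and
`τ` divisible by `x^k`, so that sorting by powers of `x` and discarding `x^d` and higher powers
gives the Fourier transform of an Edgeworth series up to `O(n^{-d/2})` with a Gaussian weight in `t`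
(`exists_edgeworthFourier_approx`). Hermite polynomials convert polynomials in `τ` into the
polynomials `P_k` (`gaussFourier_gaussDeriv_hermiteDual`). The Gaussian bound for `ψ` near the
origin that this needs follows from the bound at infinity by the doubling inequality
`1 - |φ(2s)| ≤ 4 (1 - |φ(s)|)` (`exists_norm_charFun_le_exp`). The `P_k` are unique by Fourier
inversion (`IsEdgeworthPolynomials.unique`).

*Back to distribution functions.* Esseen's smoothing inequality (`exists_esseen_smoothing`) bounds
the uniform distance by `∫_0^T |f - g| / t dt + O(1 / T)`. With `T = n^{R'}`, `R' > R`, the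
frequencies beyond `σ √n` contribute `exp (-c n^κ)`, `κ = 1 - (R' - 1/2) γ > 0`, by the hypothesis
on `φ` (`edgeworthApprox_of_norm_charFun_le`).

*Laws of finite support.* The bound `|φ| ≤ 1 - c d(s)²` comes from comparing the phases of two atoms
(`exists_norm_charFun_le_dioDist`), so a `β`-Diophantine law satisfies the decay condition with
`γ = 2 β`. Dirichlet's theorem on simultaneous approximation forces `(d - 1) β ≥ 1`
(`IsDiophantine.one_le_mul`), and then `(R - 1/2) β < 1/2` implies `R < d / 2`.
-/

/-! ### Polynomials against the Gaussian density -/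

lemma gaussianPDFReal_std (z : ℝ) :
    gaussianPDFReal 0 1 z = (√(2 * Real.pi))⁻¹ * Real.exp (-(1 / 2) * z ^ 2) := by
  simp only [gaussianPDFReal, NNReal.coe_one, mul_one, sub_zero]
  congr 2; ring

lemma pow_le_const_mul_exp_sq (m : ℕ) {c : ℝ} (hc : 0 < c) :
    ∃ C : ℝ, 0 < C ∧ ∀ x : ℝ, 0 ≤ x → x ^ m ≤ C * Real.exp (c * x ^ 2) := by
  refine ⟨m.factorial * Real.exp (1 / (4 * c)), by positivity, fun x hx => ?_⟩
  have h1 : x ^ m / m.factorial ≤ Real.exp x := Real.pow_div_factorial_le_exp x hx m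
  have h2 : x ≤ 1 / (4 * c) + c * x ^ 2 := by
    have : 1 / (4 * c) + c * x ^ 2 - x = (2 * c * x - 1) ^ 2 / (4 * c) := by field_simp; ring
    have : 0 ≤ (2 * c * x - 1) ^ 2 / (4 * c) := by positivity
    linarith
  rw [div_le_iff₀ (by positivity)] at h1
  calc x ^ m ≤ Real.exp x * m.factorial := h1
    _ ≤ Real.exp (1 / (4 * c) + c * x ^ 2) * m.factorial := by gcongr
    _ = _ := by rw [Real.exp_add]; ring

/-- A polynomial grows more slowly than `exp (c ‖z‖²)`. -/
lemma Polynomial.norm_eval_le_const_mul_exp_sq {𝕜 : Type*} [NormedField 𝕜] (P : Polynomial 𝕜)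
    {c : ℝ} (hc : 0 < c) :
    ∃ C : ℝ, 0 < C ∧ ∀ z : 𝕜, ‖P.eval z‖ ≤ C * Real.exp (c * ‖z‖ ^ 2) := by
  induction P using Polynomial.induction_on' with
  | add p q hp hq =>
    obtain ⟨C₁, h1, hp⟩ := hp
    obtain ⟨C₂, h2, hq⟩ := hq
    refine ⟨C₁ + C₂, by positivity, fun z => ?_⟩
    rw [Polynomial.eval_add, add_mul]
    exact (norm_add_le _ _).trans (add_le_add (hp z) (hq z))
  | monomial m a =>
    obtain ⟨C, hC, h⟩ := pow_le_const_mul_exp_sq m hc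
    refine ⟨(‖a‖ + 1) * C, by positivity, fun z => ?_⟩
    rw [Polynomial.eval_monomial, norm_mul, norm_pow, mul_assoc]
    have := h ‖z‖ (norm_nonneg _)
    gcongr
    linarith

lemma abs_gaussian_mul_eval_le (P : Polynomial ℝ) :
    ∃ C : ℝ, 0 < C ∧ ∀ z : ℝ,
      |gaussianPDFReal 0 1 z * P.eval z| ≤ C * Real.exp (-(1 / 4) * z ^ 2) := by
  obtain ⟨C, hC, h⟩ := P.norm_eval_le_const_mul_exp_sq (c := 1 / 4) (by norm_num)
  refine ⟨(√(2 * Real.pi))⁻¹ * C, by positivity, fun z => ?_⟩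
  have hz := h z
  rw [Real.norm_eq_abs, Real.norm_eq_abs, sq_abs] at hz
  rw [abs_mul, gaussianPDFReal_std, abs_of_nonneg (by positivity), mul_assoc, mul_assoc]
  refine mul_le_mul_of_nonneg_left ?_ (by positivity)
  calc Real.exp (-(1 / 2) * z ^ 2) * |P.eval z|
      ≤ Real.exp (-(1 / 2) * z ^ 2) * (C * Real.exp (1 / 4 * z ^ 2)) := by gcongr
    _ = C * (Real.exp (-(1 / 2) * z ^ 2) * Real.exp (1 / 4 * z ^ 2)) := by ring
    _ = _ := by rw [← Real.exp_add]; congr 2; ring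

lemma continuous_gaussianPDFReal_std : Continuous (gaussianPDFReal 0 1) := by
  rw [funext gaussianPDFReal_std]; fun_prop

lemma integrable_gaussian_mul_eval (P : Polynomial ℝ) :
    Integrable (fun z => gaussianPDFReal 0 1 z * P.eval z) := by
  obtain ⟨C, hC, h⟩ := abs_gaussian_mul_eval_le P
  refine ((integrable_exp_neg_mul_sq (b := 1 / 4) (by norm_num)).const_mul C).mono'
    (continuous_gaussianPDFReal_std.mul P.continuous).aestronglyMeasurable
    (Eventually.of_forall fun z => ?_)
  simpa using h z

/-- The operator `D` with `(𝔫 P)' = 𝔫 (D P)` for the Gaussian density `𝔫`. -/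
noncomputable def gaussDeriv (P : Polynomial ℝ) : Polynomial ℝ :=
  Polynomial.derivative P - Polynomial.X * P

lemma hasDerivAt_gaussian_mul_eval (P : Polynomial ℝ) (z : ℝ) :
    HasDerivAt (fun z => gaussianPDFReal 0 1 z * P.eval z)
      (gaussianPDFReal 0 1 z * (gaussDeriv P).eval z) z := by
  have h1 : HasDerivAt (gaussianPDFReal 0 1) (-z * gaussianPDFReal 0 1 z) z := by
    rw [funext gaussianPDFReal_std]
    have := ((((hasDerivAt_id z).pow 2).const_mul (-(1 / 2 : ℝ))).exp).const_mul (√(2 * Real.pi))⁻¹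
    convert! this using 1
    simp; ring
  convert! h1.mul (P.hasDerivAt z) using 1
  simp [gaussDeriv]; ring

/-- The Fourier transform of the function `𝔫 P`, with `𝔫` the Gaussian density. -/
noncomputable def gaussFourier (P : Polynomial ℝ) (t : ℝ) : ℂ :=
  ∫ z : ℝ, Complex.exp ((t * z : ℝ) * Complex.I) * ((gaussianPDFReal 0 1 z * P.eval z : ℝ) : ℂ)

lemma norm_cexp_mul_I (x : ℝ) : ‖Complex.exp ((x : ℂ) * Complex.I)‖ = 1 :=
  Complex.norm_exp_ofReal_mul_I x

lemma MeasureTheory.Integrable.cexp_mul_ofReal {μ : Measure ℝ} {f : ℝ → ℝ} (hf : Integrable f μ)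
    (t : ℝ) : Integrable (fun z => Complex.exp ((t * z : ℝ) * Complex.I) * ((f z : ℝ) : ℂ)) μ := by
  refine hf.ofReal.bdd_mul (c := 1) ?_ (Eventually.of_forall fun z => (norm_cexp_mul_I _).le)
  exact Continuous.aestronglyMeasurable (by fun_prop)

lemma gaussFourier_add (P Q : Polynomial ℝ) (t : ℝ) :
    gaussFourier (P + Q) t = gaussFourier P t + gaussFourier Q t := by
  unfold gaussFourier
  rw [← integral_add ((integrable_gaussian_mul_eval P).cexp_mul_ofReal t)
    ((integrable_gaussian_mul_eval Q).cexp_mul_ofReal t)]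
  congr 1; ext z; simp; ring

lemma gaussFourier_C_mul (c : ℝ) (P : Polynomial ℝ) (t : ℝ) :
    gaussFourier (Polynomial.C c * P) t = c * gaussFourier P t := by
  unfold gaussFourier
  rw [← integral_const_mul]
  congr 1; ext z; simp; ring

lemma gaussFourier_sum {ι : Type*} (s : Finset ι) (P : ι → Polynomial ℝ) (t : ℝ) :
    gaussFourier (∑ i ∈ s, P i) t = ∑ i ∈ s, gaussFourier (P i) t := by
  classical
  induction s using Finset.induction_on with
  | empty => simp [gaussFourier]
  | insert i s hi ih => rw [Finset.sum_insert hi, Finset.sum_insert hi, gaussFourier_add, ih]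

lemma gaussFourier_one (t : ℝ) : gaussFourier 1 t = Complex.exp (-t ^ 2 / 2) := by
  have h := charFun_gaussianReal (μ := 0) (v := 1) t
  rw [charFun_apply_real, gaussianReal_of_var_ne_zero _ one_ne_zero] at h
  unfold gaussianPDF at h
  rw [integral_withDensity_eq_integral_toReal_smul (by fun_prop) (by simp)] at h
  rw [gaussFourier]
  convert h using 1
  · congr 1; ext z
    rw [ENNReal.toReal_ofReal (gaussianPDFReal_nonneg _ _ _)]
    simp; ring
  · congr 1; simp; ring

lemma gaussFourier_gaussDeriv (P : Polynomial ℝ) (t : ℝ) :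
    gaussFourier (gaussDeriv P) t = -(t * Complex.I) * gaussFourier P t := by
  have h := integral_mul_deriv_eq_deriv_mul_of_integrable
    (u := fun z : ℝ => Complex.exp ((t * z : ℝ) * Complex.I))
    (u' := fun z : ℝ => Complex.exp ((t * z : ℝ) * Complex.I) * (t * Complex.I))
    (v := fun z : ℝ => ((gaussianPDFReal 0 1 z * P.eval z : ℝ) : ℂ))
    (v' := fun z : ℝ => ((gaussianPDFReal 0 1 z * (gaussDeriv P).eval z : ℝ) : ℂ))
    (fun z _ => by
      have : HasDerivAt (fun z : ℝ => ((t * z : ℝ) : ℂ) * Complex.I) (t * Complex.I) z := by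
        have := (((hasDerivAt_id z).const_mul t).ofReal_comp).mul_const Complex.I
        simpa using this
      exact this.cexp)
    (fun z _ => (hasDerivAt_gaussian_mul_eval P z).ofReal_comp)
    ((integrable_gaussian_mul_eval (gaussDeriv P)).cexp_mul_ofReal t)
    ((((integrable_gaussian_mul_eval P).cexp_mul_ofReal t).const_mul (t * Complex.I)).congr
      (Eventually.of_forall fun z => by simp only [Pi.mul_apply]; ring))
    ((integrable_gaussian_mul_eval P).cexp_mul_ofReal t)
  unfold gaussFourier
  rw [h, ← integral_const_mul, ← integral_neg]
  congr 1; ext z; ring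

/-- The Hermite polynomials with real coefficients. -/
noncomputable def realHermite (j : ℕ) : Polynomial ℝ :=
  (Polynomial.hermite j).map (Int.castRingHom ℝ)

lemma realHermite_succ (j : ℕ) :
    realHermite (j + 1) = Polynomial.C (-1) * gaussDeriv (realHermite j) := by
  simp only [realHermite, Polynomial.hermite_succ, gaussDeriv]
  simp [Polynomial.derivative_map]

lemma gaussFourier_realHermite (j : ℕ) (t : ℝ) :
    gaussFourier (realHermite j) t = (t * Complex.I) ^ j * Complex.exp (-t ^ 2 / 2) := by
  induction j with
  | zero => simp [realHermite, gaussFourier_one]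
  | succ j ih =>
    rw [realHermite_succ, gaussFourier_C_mul, gaussFourier_gaussDeriv, ih, pow_succ]
    push_cast; ring

/-- The polynomial `P` for which the Fourier transform of `(𝔫 P)'` is
`i t Q(i t) exp (-t² / 2)`. -/
noncomputable def hermiteDual (Q : Polynomial ℝ) : Polynomial ℝ :=
  ∑ j ∈ Q.support, Polynomial.C (-Q.coeff j) * realHermite j

lemma gaussFourier_gaussDeriv_hermiteDual (Q : Polynomial ℝ) (t : ℝ) :
    gaussFourier (gaussDeriv (hermiteDual Q)) t =
      (t * Complex.I) * Polynomial.aeval (t * Complex.I : ℂ) Q * Complex.exp (-t ^ 2 / 2) := by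
  rw [gaussFourier_gaussDeriv, hermiteDual, gaussFourier_sum, Polynomial.aeval_eq_sum_range,
    ← Polynomial.sum_over_range' (p := Q) (f := fun j a => a • (t * Complex.I : ℂ) ^ j) (by simp) _
      (Nat.lt_succ_self _), Polynomial.sum, Finset.mul_sum, Finset.mul_sum, Finset.sum_mul]
  refine Finset.sum_congr rfl fun j _ => ?_
  rw [gaussFourier_C_mul, gaussFourier_realHermite]
  simp; ring

/-- The polynomial `q` for which `𝔫 q` is the derivative of the Edgeworth series. -/
noncomputable def edgeworthDensity (P : ℕ → Polynomial ℝ) (r n : ℕ) : Polynomial ℝ :=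
  1 + ∑ k ∈ Finset.Icc 1 r, Polynomial.C (((n : ℝ) ^ ((k : ℝ) / 2))⁻¹) * gaussDeriv (P k)

lemma hasDerivAt_normalCDF (z : ℝ) : HasDerivAt normalCDF (gaussianPDFReal 0 1 z) z := by
  have hint := integrable_gaussianPDFReal 0 1
  have h : normalCDF = fun z => (∫ y in Set.Iic 0, gaussianPDFReal 0 1 y) +
      ∫ y in (0 : ℝ)..z, gaussianPDFReal 0 1 y := by
    ext z
    rw [← intervalIntegral.integral_Iic_sub_Iic hint.integrableOn hint.integrableOn]
    simp [normalCDF]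
  rw [h]
  exact (intervalIntegral.integral_hasDerivAt_right (hint.intervalIntegrable)
    (continuous_gaussianPDFReal_std.stronglyMeasurableAtFilter _ _)
    continuous_gaussianPDFReal_std.continuousAt).const_add _

lemma edgeworthSeries_eq (P : ℕ → Polynomial ℝ) (r n : ℕ) (z : ℝ) :
    edgeworthSeries P r n z = normalCDF z + gaussianPDFReal 0 1 z *
      (∑ k ∈ Finset.Icc 1 r, Polynomial.C (((n : ℝ) ^ ((k : ℝ) / 2))⁻¹) * P k).eval z := by
  simp only [edgeworthSeries, Polynomial.eval_finsetSum, Polynomial.eval_mul, Polynomial.eval_C]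
  congr 2
  exact Finset.sum_congr rfl fun k _ => by rw [div_eq_inv_mul]

lemma hasDerivAt_edgeworthSeries (P : ℕ → Polynomial ℝ) (r n : ℕ) (z : ℝ) :
    HasDerivAt (edgeworthSeries P r n)
      (gaussianPDFReal 0 1 z * (edgeworthDensity P r n).eval z) z := by
  rw [funext (edgeworthSeries_eq P r n)]
  convert! (hasDerivAt_normalCDF z).add (hasDerivAt_gaussian_mul_eval _ z) using 1
  rw [edgeworthDensity, gaussDeriv, Polynomial.derivative_sum, Finset.mul_sum,
    ← Finset.sum_sub_distrib, Polynomial.eval_add, mul_add, Polynomial.eval_one, mul_one]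
  congr 3
  refine Finset.sum_congr rfl fun k _ => ?_
  rw [gaussDeriv, Polynomial.derivative_C_mul]; ring

lemma fourierStieltjes_edgeworthSeries (P : ℕ → Polynomial ℝ) (r n : ℕ) (t : ℝ) :
    fourierStieltjes (edgeworthSeries P r n) t = gaussFourier (edgeworthDensity P r n) t := by
  unfold fourierStieltjes gaussFourier
  congr 1; ext z
  rw [(hasDerivAt_edgeworthSeries P r n z).deriv]

lemma gaussFourier_edgeworthDensity (P : ℕ → Polynomial ℝ) (r n : ℕ) (t : ℝ) :
    gaussFourier (edgeworthDensity P r n) t = Complex.exp (-t ^ 2 / 2) +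
      ∑ k ∈ Finset.Icc 1 r, ((((n : ℝ) ^ ((k : ℝ) / 2))⁻¹ : ℝ) : ℂ) *
        gaussFourier (gaussDeriv (P k)) t := by
  rw [edgeworthDensity, gaussFourier_add, gaussFourier_one, gaussFourier_sum]
  simp only [gaussFourier_C_mul]

lemma tendsto_gaussian_mul_eval_atBot (P : Polynomial ℝ) :
    Tendsto (fun z => gaussianPDFReal 0 1 z * P.eval z) atBot (𝓝 0) :=
  tendsto_zero_of_hasDerivAt_of_integrableOn_Iic (a := 0)
    (fun z _ => hasDerivAt_gaussian_mul_eval P z)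
    (integrable_gaussian_mul_eval _).integrableOn (integrable_gaussian_mul_eval _).integrableOn

lemma edgeworthSeries_eq_integral (P : ℕ → Polynomial ℝ) (r n : ℕ) (z : ℝ) :
    edgeworthSeries P r n z =
      ∫ y in Set.Iic z, gaussianPDFReal 0 1 y * (edgeworthDensity P r n).eval y := by
  have hint := integrable_gaussianPDFReal 0 1
  have h0 : Tendsto normalCDF atBot (𝓝 0) := by
    have h := (intervalIntegral_tendsto_integral_Iic 0 hint.integrableOn tendsto_id).const_sub
      (normalCDF 0)
    rw [show (∫ y in Set.Iic 0, gaussianPDFReal 0 1 y) = normalCDF 0 from rfl, sub_self] at h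
    refine h.congr fun z => ?_
    rw [id, ← intervalIntegral.integral_Iic_sub_Iic hint.integrableOn hint.integrableOn]
    simp [normalCDF]
  rw [integral_Iic_of_hasDerivAt_of_tendsto' (m := 0)
    (fun y _ => hasDerivAt_edgeworthSeries P r n y)
    (integrable_gaussian_mul_eval _).integrableOn, sub_zero]
  rw [funext (edgeworthSeries_eq P r n)]
  simpa using h0.add (tendsto_gaussian_mul_eval_atBot _)

/-- Fourier inversion: `(𝔫 P)'` is determined by its Fourier transform, and so is `P`, because
`𝔫 P` tends to zero. -/
lemma eq_zero_of_gaussFourier_gaussDeriv_eq_zero {P : Polynomial ℝ}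
    (h : ∀ t : ℝ, gaussFourier (gaussDeriv P) t = 0) : P = 0 := by
  set f : ℝ → ℂ := fun z => ((gaussianPDFReal 0 1 z * (gaussDeriv P).eval z : ℝ) : ℂ) with hf
  have hfi : Integrable f := (integrable_gaussian_mul_eval _).ofReal
  have hfc : Continuous f := by
    have := continuous_gaussianPDFReal_std
    fun_prop
  have hF : FourierTransform.fourier f = 0 := by
    ext w
    rw [Real.fourier_real_eq_integral_exp_smul, Pi.zero_apply, ← h (-2 * Real.pi * w), gaussFourier]
    congr 1; ext z
    rw [smul_eq_mul]
    congr 3; push_cast; ring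
  have hinv := hfc.fourierInv_fourier_eq hfi (by rw [hF]; exact integrable_zero _ _ _)
  have hz : gaussDeriv P = 0 := by
    refine Polynomial.funext fun z => ?_
    have h1 : f z = 0 := by
      rw [← hinv, hF, Real.fourierInv_eq']
      simp
    rw [hf] at h1
    have h2 : gaussianPDFReal 0 1 z * (gaussDeriv P).eval z = 0 := Complex.ofReal_eq_zero.1 h1
    rcases mul_eq_zero.1 h2 with h3 | h3
    · exact absurd h3 (gaussianPDFReal_pos _ _ _ one_ne_zero).ne'
    · simpa using h3
  by_contra hP
  have h1 : Polynomial.derivative P = Polynomial.X * P := sub_eq_zero.1 hz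
  have h2 := Polynomial.degree_derivative_lt hP
  rw [h1, Polynomial.degree_mul, Polynomial.degree_X, Polynomial.degree_eq_natDegree hP] at h2
  norm_cast at h2
  omega

/-! ### Uniqueness of the Edgeworth polynomials -/

lemma Polynomial.eq_zero_of_tendsto_natCast {p : Polynomial ℝ}
    (h : Tendsto (fun m : ℕ => p.eval (m : ℝ)) atTop (𝓝 0)) : p = 0 := by
  by_cases hp : 0 < p.degree
  · have h1 := (p.abs_tendsto_atTop hp).comp (tendsto_natCast_atTop_atTop (R := ℝ))
    exact absurd h1 (not_tendsto_atTop_of_tendsto_nhds h.abs)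
  · rw [Polynomial.eq_C_of_degree_le_zero (not_lt.1 hp)] at h ⊢
    simpa using h

lemma eq_zero_of_tendsto_sum_pow {r : ℕ} {A : ℕ → ℝ}
    (h : Tendsto (fun m : ℕ => ∑ k ∈ Finset.Icc 1 r, (m : ℝ) ^ (r - k) * A k) atTop (𝓝 0)) :
    ∀ k ∈ Finset.Icc 1 r, A k = 0 := by
  have h1 : (∑ k ∈ Finset.Icc 1 r, Polynomial.monomial (r - k) (A k)) = 0 := by
    refine Polynomial.eq_zero_of_tendsto_natCast (h.congr fun m => ?_)
    simp [Polynomial.eval_finsetSum, mul_comm]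
  intro k hk
  have h2 := congrArg (fun q => Polynomial.coeff q (r - k)) h1
  simp only [Polynomial.finsetSum_coeff, Polynomial.coeff_monomial, Polynomial.coeff_zero] at h2
  rw [Finset.sum_eq_single_of_mem k hk] at h2
  · simpa using h2
  · intro j hj hjk
    rw [if_neg]
    rw [Finset.mem_Icc] at hj hk
    omega

lemma complex_eq_zero_of_tendsto_sum_pow {r : ℕ} {A : ℕ → ℂ}
    (h : Tendsto (fun m : ℕ => ∑ k ∈ Finset.Icc 1 r, (((m : ℝ) ^ (r - k) : ℝ) : ℂ) * A k)
      atTop (𝓝 0)) :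
    ∀ k ∈ Finset.Icc 1 r, A k = 0 := by
  intro k hk
  have hre := (Complex.continuous_re.tendsto 0).comp h
  have him := (Complex.continuous_im.tendsto 0).comp h
  simp only [Function.comp_def, Complex.re_sum, Complex.im_sum, Complex.re_ofReal_mul,
    Complex.im_ofReal_mul, Complex.zero_re, Complex.zero_im] at hre him
  exact Complex.ext (eq_zero_of_tendsto_sum_pow hre k hk) (eq_zero_of_tendsto_sum_pow him k hk)

/-- The polynomials of an Edgeworth series are unique. Along the squares `n = m²` the difference
of two expansions, multiplied by `n^{r/2}`, is a polynomial in `m` that tends to zero. -/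
lemma IsEdgeworthPolynomials.unique {φ : ℝ → ℂ} {σ : ℝ} {r : ℕ} {P Q : ℕ → Polynomial ℝ}
    (hP : IsEdgeworthPolynomials φ σ r P) (hQ : IsEdgeworthPolynomials φ σ r Q) :
    ∀ k ∈ Finset.Icc 1 r, P k = Q k := by
  intro k hk
  rw [← sub_eq_zero]
  refine eq_zero_of_gaussFourier_gaussDeriv_eq_zero fun t => ?_
  refine complex_eq_zero_of_tendsto_sum_pow
    (A := fun k => gaussFourier (gaussDeriv (P k - Q k)) t) ?_ k hk
  have h := ((hQ t).sub (hP t)).comp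
    ((tendsto_pow_atTop (two_ne_zero)).comp (tendsto_id (α := ℕ)))
  rw [sub_zero] at h
  refine h.congr' ?_
  filter_upwards [eventually_ge_atTop 1] with m hm
  have hm0 : (m : ℝ) ≠ 0 := by positivity
  have hpow : ∀ j : ℕ, (((m ^ 2 : ℕ) : ℝ)) ^ ((j : ℝ) / 2) = (m : ℝ) ^ j := fun j => by
    push_cast
    rw [← Real.rpow_natCast, ← Real.rpow_natCast, ← Real.rpow_mul (by positivity)]
    congr 1; push_cast; ring
  simp only [Function.comp_apply, id, fourierStieltjes_edgeworthSeries,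
    gaussFourier_edgeworthDensity, hpow]
  rw [← mul_sub, sub_sub_sub_cancel_left, add_sub_add_left_eq_sub, ← Finset.sum_sub_distrib,
    Finset.mul_sum]
  refine Finset.sum_congr rfl fun j hj => ?_
  have h1 : gaussFourier (gaussDeriv (P j - Q j)) t =
      gaussFourier (gaussDeriv (P j)) t - gaussFourier (gaussDeriv (Q j)) t := by
    have h3 : P j - Q j = P j + Polynomial.C (-1) * Q j := by simp [sub_eq_add_neg]
    rw [gaussFourier_gaussDeriv, gaussFourier_gaussDeriv, gaussFourier_gaussDeriv, h3,
      gaussFourier_add, gaussFourier_C_mul]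
    push_cast; ring
  have h2 : (m : ℝ) ^ (r - j) = (m : ℝ) ^ r * ((m : ℝ) ^ j)⁻¹ := by
    rw [pow_sub₀ _ hm0 (Finset.mem_Icc.1 hj).2]
  rw [h1, h2]
  push_cast; ring

lemma edgeworthSeries_congr {P Q : ℕ → Polynomial ℝ} {r : ℕ}
    (h : ∀ k ∈ Finset.Icc 1 r, P k = Q k) (n : ℕ) (z : ℝ) :
    edgeworthSeries P r n z = edgeworthSeries Q r n z := by
  unfold edgeworthSeries
  rw [Finset.sum_congr rfl fun k hk => by rw [h k hk]]

/-! ### Esseen's smoothing inequality -/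

/-- The Fejér kernel (up to a constant factor). -/
noncomputable def fejerKernel (y : ℝ) : ℝ := 2 * (1 - Real.cos y) / y ^ 2

lemma fejerKernel_nonneg (y : ℝ) : 0 ≤ fejerKernel y := by
  have := Real.cos_le_one y
  unfold fejerKernel
  have : 0 ≤ 1 - Real.cos y := by linarith
  positivity

lemma measurable_fejerKernel : Measurable fejerKernel := by
  unfold fejerKernel; fun_prop

lemma fejerKernel_le (y : ℝ) : fejerKernel y ≤ 5 * (1 + y ^ 2)⁻¹ := by
  unfold fejerKernel
  rcases eq_or_ne y 0 with rfl | hy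
  · simp
  have h1 := Real.one_sub_sq_div_two_le_cos (x := y)
  have h2 := Real.neg_one_le_cos y
  rw [← div_eq_mul_inv, div_le_div_iff₀ (by positivity) (by positivity)]
  nlinarith [sq_nonneg y]

lemma integrable_fejerKernel : Integrable fejerKernel :=
  (integrable_inv_one_add_sq.const_mul 5).mono' measurable_fejerKernel.aestronglyMeasurable
    (Eventually.of_forall fun y => by
      rw [Real.norm_of_nonneg (fejerKernel_nonneg y)]; exact fejerKernel_le y)

lemma integral_fejerKernel_pos : 0 < ∫ y, fejerKernel y := by
  rw [integral_pos_iff_support_of_nonneg fejerKernel_nonneg integrable_fejerKernel]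
  have hsub : Set.Ioo 0 1 ⊆ Function.support fejerKernel := by
    intro y hy
    have h0 : 0 < y := hy.1
    have h1 : Real.cos y ≠ 1 := fun h => h0.ne' <|
      (Real.cos_eq_one_iff_of_lt_of_lt (by linarith [Real.pi_gt_three])
        (by linarith [Real.pi_gt_three, hy.2])).1 h
    have h2 : 0 < 1 - Real.cos y := sub_pos.2 (lt_of_le_of_ne (Real.cos_le_one y) h1)
    have h3 : 0 < fejerKernel y := by unfold fejerKernel; positivity
    exact h3.ne'
  refine lt_of_lt_of_le ?_ (measure_mono hsub)
  simp

/-- The Fejér kernel is the Fourier transform of a function of compact support. -/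
lemma integral_triangle_mul_cos {T : ℝ} (hT : 0 < T) {y : ℝ} (hy : y ≠ 0) :
    ∫ t in (0 : ℝ)..T, 2 * (1 - t / T) * Real.cos (t * y) = T * fejerKernel (T * y) := by
  have h : ∀ t ∈ Set.uIcc 0 T, HasDerivAt
      (fun t => 2 * (1 - t / T) * (Real.sin (t * y) / y) - 2 * Real.cos (t * y) / (T * y ^ 2))
      (2 * (1 - t / T) * Real.cos (t * y)) t := by
    intro t _
    have h1 : HasDerivAt (fun t : ℝ => t * y) y t := by simpa using (hasDerivAt_id t).mul_const y
    have h2 : HasDerivAt (fun t : ℝ => 2 * (1 - t / T)) (2 * (-(1 / T))) t :=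
      (((hasDerivAt_id t).div_const T).const_sub 1).const_mul 2
    convert! (h2.mul (h1.sin.div_const y)).sub ((h1.cos.const_mul 2).div_const (T * y ^ 2)) using 1
    field_simp; ring
  rw [intervalIntegral.integral_eq_sub_of_hasDerivAt h
    (Continuous.intervalIntegrable (by fun_prop) _ _)]
  unfold fejerKernel
  simp
  field_simp; ring

/-- The integral of `w ↦ exp (-i t w)` between `z₀` and `z`. -/
noncomputable def expIntegral (z₀ z t : ℝ) : ℂ :=
  ∫ w in z₀..z, Complex.exp ((-(t * w) : ℝ) * Complex.I)

lemma norm_expIntegral_le (z₀ z : ℝ) {t : ℝ} (ht : 0 < t) : ‖expIntegral z₀ z t‖ ≤ 2 / t := by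
  have h1 : (-(t : ℂ) * Complex.I) ≠ 0 := by
    simp [ht.ne', Complex.I_ne_zero]
  have h2 : expIntegral z₀ z t = (Complex.exp ((-(t * z) : ℝ) * Complex.I) -
      Complex.exp ((-(t * z₀) : ℝ) * Complex.I)) / (-(t : ℂ) * Complex.I) := by
    have h3 := integral_exp_mul_complex (a := z₀) (b := z) h1
    unfold expIntegral
    have e : ∀ w : ℝ, -(t : ℂ) * Complex.I * w = ((-(t * w) : ℝ) : ℂ) * Complex.I := fun w => by
      push_cast; ring
    simpa only [e] using h3
  rw [h2, norm_div]
  have h3 : ‖-(t : ℂ) * Complex.I‖ = t := by simp [abs_of_pos ht]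
  rw [h3]
  gcongr
  refine (norm_sub_le _ _).trans ?_
  rw [Complex.norm_exp_ofReal_mul_I, Complex.norm_exp_ofReal_mul_I]
  norm_num

lemma norm_expIntegral_le_sub {z₀ z : ℝ} (h : z₀ ≤ z) (t : ℝ) :
    ‖expIntegral z₀ z t‖ ≤ z - z₀ := by
  have := intervalIntegral.norm_integral_le_of_norm_le_const (a := z₀) (b := z) (C := 1)
    (f := fun w : ℝ => Complex.exp ((-(t * w) : ℝ) * Complex.I))
    (fun w _ => (Complex.norm_exp_ofReal_mul_I _).le)
  rwa [one_mul, abs_of_nonneg (by linarith)] at this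

lemma continuous_expIntegral (z₀ z : ℝ) : Continuous (expIntegral z₀ z) := by
  unfold expIntegral
  exact intervalIntegral.continuous_parametric_intervalIntegral_of_continuous' (by fun_prop) _ _

/-- The antiderivative of the Fejér kernel, in terms of its Fourier transform. -/
lemma integral_scaled_fejerKernel {T : ℝ} (hT : 0 < T) (z₀ z x : ℝ) :
    ∫ w in z₀..z, T * fejerKernel (T * (w - x)) =
      ∫ t in (0 : ℝ)..T, 2 * (1 - t / T) *
        (expIntegral z₀ z t * Complex.exp ((t * x : ℝ) * Complex.I)).re := by
  have h1 : ∫ w in z₀..z, T * fejerKernel (T * (w - x)) =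
      ∫ w in z₀..z, ∫ t in (0 : ℝ)..T, 2 * (1 - t / T) * Real.cos (t * (w - x)) := by
    refine intervalIntegral.integral_congr_ae ?_
    have : ∀ᵐ w : ℝ, w ≠ x := by simp [ae_iff]
    filter_upwards [this] with w hw _
    rw [integral_triangle_mul_cos hT (sub_ne_zero.2 hw)]
  rw [h1, intervalIntegral_intervalIntegral_swap]
  · refine intervalIntegral.integral_congr fun t _ => ?_
    rw [intervalIntegral.integral_const_mul]
    congr 1
    rw [expIntegral, ← intervalIntegral.integral_mul_const, ← Complex.reCLM_apply,
      ← ContinuousLinearMap.intervalIntegral_comp_comm]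
    · refine intervalIntegral.integral_congr fun w _ => ?_
      simp only [Complex.reCLM_apply]
      rw [← Complex.exp_add, ← add_mul, ← Complex.ofReal_add, Complex.exp_ofReal_mul_I_re,
        ← Real.cos_neg]
      congr 1; ring
    · exact Continuous.intervalIntegrable (by fun_prop) _ _
  · refine IntegrableOn.mono_set (t := Set.uIcc z₀ z ×ˢ Set.uIcc 0 T) ?_
      (Set.prod_mono Set.uIoc_subset_uIcc Set.uIoc_subset_uIcc)
    refine ContinuousOn.integrableOn_compact (isCompact_uIcc.prod isCompact_uIcc) ?_
    exact Continuous.continuousOn (by unfold Function.uncurry; fun_prop)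

lemma integrable_scaled_fejerKernel {T : ℝ} (hT : 0 < T) :
    Integrable fun y => T * fejerKernel (T * y) :=
  (integrable_fejerKernel.comp_mul_left' hT.ne').const_mul T

lemma integral_scaled_fejerKernel_eq {T : ℝ} (hT : 0 < T) :
    ∫ y, T * fejerKernel (T * y) = ∫ y, fejerKernel y := by
  rw [integral_const_mul, Measure.integral_comp_mul_left, abs_of_pos (by positivity), smul_eq_mul,
    mul_inv_cancel_left₀ hT.ne']

/-- Parseval's identity for the increments of the distribution function of `g dμ`, smoothed by the
Fejér kernel: only the Fourier transform of `g dμ` on `[0, T]` enters. -/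
lemma integral_increment_mul_fejerKernel {μ : Measure ℝ} [SFinite μ] {g : ℝ → ℝ}
    (hg : Integrable g μ) {T : ℝ} (hT : 0 < T) {z₀ z : ℝ} (hz : z₀ ≤ z) :
    ∫ y, ((∫ x in Set.Iic (z - y), g x ∂μ) - ∫ x in Set.Iic (z₀ - y), g x ∂μ) *
        (T * fejerKernel (T * y)) =
      ∫ t in (0 : ℝ)..T, 2 * (1 - t / T) *
        (expIntegral z₀ z t * ∫ x, Complex.exp ((t * x : ℝ) * Complex.I) * (g x : ℂ) ∂μ).re := by
  have h1 : ∀ y, ((∫ x in Set.Iic (z - y), g x ∂μ) - ∫ x in Set.Iic (z₀ - y), g x ∂μ) *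
      (T * fejerKernel (T * y)) = ∫ x, (Set.Ioc z₀ z).indicator (fun _ => (1 : ℝ)) (y + x) *
        ((T * fejerKernel (T * y)) * g x) ∂μ := by
    intro y
    rw [← integral_indicator measurableSet_Iic, ← integral_indicator measurableSet_Iic,
      ← integral_sub (hg.indicator measurableSet_Iic) (hg.indicator measurableSet_Iic),
      ← integral_mul_const]
    congr 1; ext x
    simp only [Set.indicator, Set.mem_Iic, Set.mem_Ioc]
    by_cases ha : x ≤ z - y <;> by_cases hb : x ≤ z₀ - y
    · rw [if_pos ha, if_pos hb, if_neg (by rintro ⟨h, -⟩; linarith)]; ring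
    · rw [if_pos ha, if_neg hb, if_pos ⟨by linarith, by linarith⟩]; ring
    · exact absurd (hb.trans (by linarith)) ha
    · rw [if_neg ha, if_neg hb, if_neg (by rintro ⟨-, h⟩; exact ha (by linarith))]; ring
  simp_rw [h1]
  rw [integral_integral_swap]
  swap
  · refine ((integrable_scaled_fejerKernel hT).mul_prod hg).bdd_mul (c := 1) ?_ ?_
    · exact ((measurable_const.indicator measurableSet_Ioc).comp
        (measurable_fst.add measurable_snd)).aestronglyMeasurable
    · refine Eventually.of_forall fun p => (norm_indicator_le_norm_self _ _).trans ?_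
      simp
  have h2 : ∀ x, ∫ y, (Set.Ioc z₀ z).indicator (fun _ => (1 : ℝ)) (y + x) *
      ((T * fejerKernel (T * y)) * g x) = ∫ t in (0 : ℝ)..T, (2 * (1 - t / T) *
        (expIntegral z₀ z t * Complex.exp ((t * x : ℝ) * Complex.I)).re) * g x := by
    intro x
    rw [intervalIntegral.integral_mul_const, ← integral_scaled_fejerKernel hT,
      intervalIntegral.integral_of_le hz, ← integral_indicator measurableSet_Ioc,
      ← integral_mul_const]
    rw [← integral_sub_right_eq_self _ x]
    congr 1; ext w
    simp only [sub_add_cancel, Set.indicator]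
    split_ifs <;> ring
  simp_rw [h2]
  rw [← intervalIntegral_integral_swap]
  · refine intervalIntegral.integral_congr fun t _ => ?_
    rw [← integral_const_mul, ← Complex.reCLM_apply, ← ContinuousLinearMap.integral_comp_comm _
      ((hg.cexp_mul_ofReal t).const_mul _), ← integral_const_mul]
    congr 1; ext x
    rw [Complex.reCLM_apply, ← mul_assoc, Complex.re_mul_ofReal]
    ring
  · have : IsFiniteMeasure (volume.restrict (Set.uIoc 0 T)) := ⟨by
      rw [Measure.restrict_apply_univ, Set.uIoc_of_le hT.le]; exact measure_Ioc_lt_top⟩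
    have hb : Integrable (fun p : ℝ × ℝ => (1 : ℝ) * g p.2)
        ((volume.restrict (Set.uIoc 0 T)).prod μ) :=
      (integrable_const (1 : ℝ)).mul_prod hg
    have hb2 : Integrable (fun p : ℝ × ℝ => g p.2)
        ((volume.restrict (Set.uIoc 0 T)).prod μ) := by simpa using hb
    unfold Function.uncurry
    refine hb2.bdd_mul (c := 2 * (z - z₀)) ?_ ?_
    · have := continuous_expIntegral z₀ z
      exact Continuous.aestronglyMeasurable (by fun_prop)
    · have hae : ∀ᵐ p ∂((volume.restrict (Set.uIoc 0 T)).prod μ), p.1 ∈ Set.uIoc 0 T :=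
        Measure.quasiMeasurePreserving_fst.ae (ae_restrict_mem measurableSet_uIoc)
      filter_upwards [hae] with p hp
      rw [Set.uIoc_of_le hT.le] at hp
      have h3 : p.1 / T ≤ 1 := (div_le_one hT).2 hp.2
      have h4 : 0 ≤ p.1 / T := div_nonneg hp.1.le hT.le
      rw [norm_mul, Real.norm_of_nonneg (by linarith)]
      have h5 :
          ‖(expIntegral z₀ z p.1 * Complex.exp ((p.1 * p.2 : ℝ) * Complex.I)).re‖ ≤ z - z₀ := by
        refine (Complex.abs_re_le_norm _).trans ?_
        rw [norm_mul, Complex.norm_exp_ofReal_mul_I, mul_one]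
        exact norm_expIntegral_le_sub hz _
      have : 0 ≤ z - z₀ := by linarith
      gcongr
      linarith

/-- If `Δ` exceeds `ρ` at a point and decreases at a rate of at most `m` to the right of it, then
`Δ`, smoothed by the Fejér kernel, is large at a nearby point. -/
lemma le_of_smoothed_le {Δ : ℝ → ℝ} (hΔ : Measurable Δ) {η : ℝ} (hη : ∀ x, |Δ x| ≤ η)
    {x₀ m T A B : ℝ} (hm : 0 ≤ m) (hT : 0 < T)
    (htail : ∫ y, {y : ℝ | A < |y|}.indicator fejerKernel y ≤ (∫ y, fejerKernel y) / 8)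
    (hlow : ∀ h, 0 ≤ h → Δ x₀ - m * h ≤ Δ (x₀ + h))
    (hB : ∀ z, |∫ y, Δ (z - y) * (T * fejerKernel (T * y))| ≤ B * ∫ y, fejerKernel y) :
    Δ x₀ ≤ 2 * m * A / T + 8 / 7 * B + η / 7 := by
  set J := ∫ y, fejerKernel y with hJ
  have hJ0 : 0 < J := integral_fejerKernel_pos
  set ρ := Δ x₀ - 2 * m * A / T with hρ
  have hη0 : 0 ≤ η := (abs_nonneg _).trans (hη 0)
  have hB0 : 0 ≤ B := by
    have := (abs_nonneg _).trans (hB 0)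
    exact nonneg_of_mul_nonneg_left this hJ0
  -- `Δ ≥ ρ` on an interval of length `2 A / T` to the right of `x₀`, with midpoint `x₀ + A / T`
  rcases le_or_gt ρ 0 with h0 | h0
  · have : Δ x₀ ≤ 2 * m * A / T := by linarith
    linarith
  have hset : MeasurableSet {y : ℝ | A < |y|} := measurableSet_lt measurable_const measurable_norm
  set τ : ℝ → ℝ := {y : ℝ | A < |y|}.indicator fejerKernel with hτ
  have hτi : Integrable τ := integrable_fejerKernel.indicator hset
  have hτi' : Integrable fun y => T * τ (T * y) := (hτi.comp_mul_left' hT.ne').const_mul T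
  have hκi := integrable_scaled_fejerKernel hT
  have hτint : ∫ y, T * τ (T * y) = ∫ y, τ y := by
    rw [integral_const_mul, Measure.integral_comp_mul_left, abs_of_pos (by positivity), smul_eq_mul,
      mul_inv_cancel_left₀ hT.ne']
  set z := x₀ + A / T with hz
  have key : ∫ y, (ρ * (T * fejerKernel (T * y)) - (ρ + η) * (T * τ (T * y))) ≤
      ∫ y, Δ (z - y) * (T * fejerKernel (T * y)) := by
    refine integral_mono ((hκi.const_mul _).sub (hτi'.const_mul _)) ?_ fun y => ?_
    · refine hκi.bdd_mul (c := η) ?_ (Eventually.of_forall fun y => hη _)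
      exact (hΔ.comp (measurable_const.sub measurable_id)).aestronglyMeasurable
    · have hk : 0 ≤ T * fejerKernel (T * y) := mul_nonneg hT.le (fejerKernel_nonneg _)
      by_cases hy : A < |T * y|
      · have : τ (T * y) = fejerKernel (T * y) := Set.indicator_of_mem (s := {y : ℝ | A < |y|}) hy _
        simp only [this]
        have := (abs_le.1 (hη (z - y))).1
        nlinarith
      · have : τ (T * y) = 0 := Set.indicator_of_notMem (s := {y : ℝ | A < |y|}) hy _
        simp only [this]
        rw [mul_zero, mul_zero, sub_zero]
        refine mul_le_mul_of_nonneg_right ?_ hk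
        have h1 := abs_le.1 (not_lt.1 hy)
        have h2 : y ≤ A / T := by rw [le_div_iff₀ hT]; linarith
        have h3 : -(A / T) ≤ y := by rw [← neg_div, div_le_iff₀ hT]; linarith
        have h4 := hlow (A / T - y) (by linarith)
        have h5 : x₀ + (A / T - y) = z - y := by rw [hz]; ring
        rw [h5] at h4
        have h6 : m * (A / T - y) ≤ 2 * m * A / T := by
          have : 2 * m * A / T = m * (A / T - -(A / T)) := by ring
          rw [this]
          gcongr
        rw [hρ]; linarith
  rw [integral_sub (hκi.const_mul _) (hτi'.const_mul _), integral_const_mul ρ,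
    integral_const_mul (ρ + η),
    integral_scaled_fejerKernel_eq hT, hτint] at key
  have h7 := (le_abs_self _).trans (hB z)
  have h8 : (ρ + η) * ∫ y, τ y ≤ (ρ + η) * (J / 8) := by gcongr
  have h9 : (ρ * (7 / 8) - η / 8) * J ≤ B * J := by linarith
  have h10 := le_of_mul_le_mul_right h9 hJ0
  rw [hρ] at h10
  linarith

lemma exists_fejerKernel_tail_le :
    ∃ A : ℝ, 0 ≤ A ∧
      ∫ y : ℝ, {y : ℝ | A < |y|}.indicator fejerKernel y ≤ (∫ y, fejerKernel y) / 8 := by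
  have h : Tendsto (fun A : ℝ => ∫ y : ℝ, {y : ℝ | A < |y|}.indicator fejerKernel y) atTop
      (𝓝 (∫ _ : ℝ, (0 : ℝ))) := by
    refine tendsto_integral_filter_of_dominated_convergence fejerKernel ?_ ?_
      integrable_fejerKernel ?_
    · exact Eventually.of_forall fun A => (measurable_fejerKernel.indicator
        (measurableSet_lt measurable_const measurable_norm)).aestronglyMeasurable
    · refine Eventually.of_forall fun A => Eventually.of_forall fun y => ?_
      refine (norm_indicator_le_norm_self _ _).trans ?_
      rw [Real.norm_of_nonneg (fejerKernel_nonneg y)]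
    · refine Eventually.of_forall fun y => tendsto_const_nhds.congr' ?_
      filter_upwards [eventually_ge_atTop |y|] with A hA
      exact (Set.indicator_of_notMem (by simpa using hA) _).symm
  rw [integral_zero] at h
  have hJ : 0 < (∫ y, fejerKernel y) / 8 := by have := integral_fejerKernel_pos; positivity
  obtain ⟨A, h1, h2⟩ := ((eventually_ge_atTop 0).and (h.eventually_le_const hJ)).exists
  exact ⟨A, h1, h2⟩

lemma tendsto_setIntegral_Iic_atBot {μ : Measure ℝ} {g : ℝ → ℝ} (hg : Integrable g μ) :
    Tendsto (fun z => ∫ x in Set.Iic z, g x ∂μ) atBot (𝓝 0) := by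
  have h : Tendsto (fun z => ∫ x, (Set.Iic z).indicator g x ∂μ) atBot (𝓝 (∫ _, (0 : ℝ) ∂μ)) := by
    refine tendsto_integral_filter_of_dominated_convergence (fun x => ‖g x‖) ?_ ?_ hg.norm ?_
    · exact Eventually.of_forall fun z => (hg.indicator measurableSet_Iic).aestronglyMeasurable
    · exact Eventually.of_forall fun z => Eventually.of_forall fun y =>
        norm_indicator_le_norm_self _ _
    · refine Eventually.of_forall fun y => tendsto_const_nhds.congr' ?_
      filter_upwards [eventually_lt_atBot y] with z hz
      exact (Set.indicator_of_notMem (by simpa using hz) _).symm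
  simpa [integral_indicator measurableSet_Iic] using h

/-- **Esseen's smoothing inequality**: the distance in the uniform norm between the distribution
function of a probability measure and the primitive of a bounded function `q` is controlled by the
difference of their Fourier transforms on `[0, T]`, up to an error `O(‖q‖_∞ / T)`. -/
theorem exists_esseen_smoothing :
    ∃ C : ℝ, 0 < C ∧ ∀ (ν : Measure ℝ) [IsProbabilityMeasure ν] (q : ℝ → ℝ), Integrable q →
      ∀ m : ℝ, (∀ x, |q x| ≤ m) → ∀ T : ℝ, 0 < T →
      ∀ b : ℝ → ℝ, IntervalIntegrable b volume 0 T →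
      (∀ t ∈ Set.Ioc 0 T,
        ‖charFun ν t - ∫ x, Complex.exp ((t * x : ℝ) * Complex.I) * (q x : ℂ)‖ ≤ t * b t) →
      ∀ z, |ν.real (Set.Iic z) - ∫ x in Set.Iic z, q x| ≤
        C * ((∫ t in (0 : ℝ)..T, b t) + m / T) := by
  obtain ⟨A, hA, htail⟩ := exists_fejerKernel_tail_le
  set J := ∫ y, fejerKernel y with hJ
  have hJ0 : 0 < J := integral_fejerKernel_pos
  refine ⟨3 * A + 6 / J, by positivity, ?_⟩
  intro ν _ q hq m hm T hT b hb hbd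
  set F : ℝ → ℝ := fun z => ∫ _ in Set.Iic z, (1 : ℝ) ∂ν with hF
  set G : ℝ → ℝ := fun z => ∫ x in Set.Iic z, q x with hG
  set Δ : ℝ → ℝ := fun z => F z - G z with hΔ
  have hFreal : ∀ z, F z = ν.real (Set.Iic z) := fun z => by simp [hF]
  have hm0 : 0 ≤ m := (abs_nonneg _).trans (hm 0)
  have hFmono : Monotone F := fun x y hxy => by
    rw [hFreal, hFreal]; exact measureReal_mono (Set.Iic_subset_Iic.2 hxy)
  have hGlip : ∀ x y, x ≤ y → |G y - G x| ≤ m * (y - x) := fun x y hxy => by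
    have h1 := intervalIntegral.integral_Iic_sub_Iic (a := x) (b := y) hq.integrableOn
      hq.integrableOn
    have h2 := intervalIntegral.norm_integral_le_of_norm_le_const (a := x) (b := y) (f := q)
      (C := m) (fun t _ => hm t)
    rwa [← h1, abs_of_nonneg (sub_nonneg.2 hxy)] at h2
  have hGcont : Continuous G := by
    refine (LipschitzWith.of_dist_le_mul (K := ⟨m, hm0⟩) fun x y => ?_).continuous
    rw [Real.dist_eq, Real.dist_eq]
    rcases le_total x y with h | h
    · rw [abs_sub_comm, abs_sub_comm x, abs_of_nonneg (sub_nonneg.2 h)]; exact hGlip x y h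
    · rw [abs_of_nonneg (sub_nonneg.2 h)]; exact hGlip y x h
  have hΔm : Measurable Δ := hFmono.measurable.sub hGcont.measurable
  have hFb : ∀ z, |F z| ≤ 1 := fun z => by
    rw [hFreal, abs_of_nonneg measureReal_nonneg]; exact measureReal_le_one
  have hGb : ∀ z, |G z| ≤ ∫ x, |q x| := fun z =>
    (norm_integral_le_integral_norm q).trans
      (setIntegral_le_integral hq.norm (Eventually.of_forall fun x => norm_nonneg _))
  have hbound : ∀ z, |Δ z| ≤ 1 + ∫ x, |q x| := fun z =>
    (abs_sub (F z) (G z)).trans (add_le_add (hFb z) (hGb z))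
  have hκi := integrable_scaled_fejerKernel hT
  have hint : ∀ z, Integrable fun y => Δ (z - y) * (T * fejerKernel (T * y)) := fun z =>
    hκi.bdd_mul (c := 1 + ∫ x, |q x|)
      (hΔm.comp (measurable_const.sub measurable_id)).aestronglyMeasurable
      (Eventually.of_forall fun y => hbound _)
  -- the increments of the smoothed difference, by Parseval's identity
  have hinc : ∀ z₀ z, z₀ ≤ z → |(∫ y, Δ (z - y) * (T * fejerKernel (T * y))) -
      ∫ y, Δ (z₀ - y) * (T * fejerKernel (T * y))| ≤ 4 * ∫ t in (0 : ℝ)..T, b t := by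
    intro z₀ z hz
    have h1 := integral_increment_mul_fejerKernel (integrable_const (μ := ν) (1 : ℝ)) hT hz
    have h2 := integral_increment_mul_fejerKernel hq hT hz
    have hi : ∀ {H : ℝ → ℝ}, Measurable H → ∀ c : ℝ, (∀ x, |H x| ≤ c) → ∀ z,
        Integrable fun y => H (z - y) * (T * fejerKernel (T * y)) := fun hH c hc z =>
      hκi.bdd_mul (c := c) (hH.comp (measurable_const.sub measurable_id)).aestronglyMeasurable
        (Eventually.of_forall fun y => hc _)
    have hFi := hi hFmono.measurable 1 hFb
    have hGi := hi hGcont.measurable _ hGb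
    have h3 : (∫ y, Δ (z - y) * (T * fejerKernel (T * y))) -
        (∫ y, Δ (z₀ - y) * (T * fejerKernel (T * y))) =
        (∫ y, (F (z - y) - F (z₀ - y)) * (T * fejerKernel (T * y))) -
        ∫ y, (G (z - y) - G (z₀ - y)) * (T * fejerKernel (T * y)) := by
      rw [← integral_sub (hint z) (hint z₀), ← integral_sub]
      · congr 1; ext y; simp only [hΔ]; ring
      · exact ((hFi z).sub (hFi z₀)).congr (Eventually.of_forall fun y => by
          simp only [Pi.sub_apply]; ring)
      · exact ((hGi z).sub (hGi z₀)).congr (Eventually.of_forall fun y => by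
          simp only [Pi.sub_apply]; ring)
    have hc1 : Continuous fun t : ℝ => ∫ x, Complex.exp ((t * x : ℝ) * Complex.I) *
        ((1 : ℝ) : ℂ) ∂ν :=
      continuous_of_dominated (bound := fun _ => 1)
        (fun t => Continuous.aestronglyMeasurable (by fun_prop))
        (fun t => Eventually.of_forall fun x => by
          rw [norm_mul, norm_cexp_mul_I]; simp)
        (integrable_const _) (Eventually.of_forall fun x => by fun_prop)
    have hc2 : Continuous fun t : ℝ => ∫ x, Complex.exp ((t * x : ℝ) * Complex.I) * (q x : ℂ) :=
      continuous_of_dominated (bound := fun x => ‖q x‖)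
        (fun t => (hq.cexp_mul_ofReal t).aestronglyMeasurable)
        (fun t => Eventually.of_forall fun x => by
          rw [norm_mul, norm_cexp_mul_I, one_mul, Complex.norm_real])
        hq.norm (Eventually.of_forall fun x => by fun_prop)
    have hc3 := continuous_expIntegral z₀ z
    rw [h3, h1, h2, ← intervalIntegral.integral_sub
      (Continuous.intervalIntegrable (by fun_prop) _ _)
      (Continuous.intervalIntegrable (by fun_prop) _ _), ← Real.norm_eq_abs,
      ← intervalIntegral.integral_const_mul]
    refine intervalIntegral.norm_integral_le_of_norm_le hT.le
      (Eventually.of_forall fun t ht => ?_) (hb.const_mul 4)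
    have h4 : ‖charFun ν t - ∫ x, Complex.exp ((t * x : ℝ) * Complex.I) * (q x : ℂ)‖ ≤ t * b t :=
      hbd t ht
    have h5 : charFun ν t = ∫ x, Complex.exp ((t * x : ℝ) * Complex.I) * ((1 : ℝ) : ℂ) ∂ν := by
      rw [charFun_apply_real]; simp
    rw [← mul_sub, ← Complex.sub_re, ← mul_sub, ← h5, norm_mul]
    have h6 : t / T ≤ 1 := (div_le_one hT).2 ht.2
    have h7 : 0 ≤ t / T := div_nonneg ht.1.le hT.le
    rw [Real.norm_of_nonneg (by linarith)]
    calc _ ≤ 2 * (2 / t * (t * b t)) := by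
          gcongr
          · linarith
          · refine (Complex.abs_re_le_norm _).trans ?_
            rw [norm_mul]
            exact mul_le_mul (norm_expIntegral_le z₀ z ht.1) h4 (norm_nonneg _)
              (div_nonneg zero_le_two ht.1.le)
      _ = 4 * b t := by have := ht.1.ne'; field_simp; ring
  -- letting `z₀` tend to `-∞` removes the second term of the increment
  have hsm : ∀ z, |∫ y, Δ (z - y) * (T * fejerKernel (T * y))| ≤ 4 * ∫ t in (0 : ℝ)..T, b t := by
    intro z
    have hΔ0 : Tendsto Δ atBot (𝓝 0) := by
      have := (tendsto_setIntegral_Iic_atBot (integrable_const (μ := ν) (1 : ℝ))).sub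
        (tendsto_setIntegral_Iic_atBot hq)
      rwa [sub_zero] at this
    have h0 : Tendsto (fun z₀ => ∫ y, Δ (z₀ - y) * (T * fejerKernel (T * y))) atBot
        (𝓝 (∫ _ : ℝ, (0 : ℝ))) := by
      refine tendsto_integral_filter_of_dominated_convergence
        (fun y => (1 + ∫ x, |q x|) * (T * fejerKernel (T * y)))
        (Eventually.of_forall fun z => (hint z).aestronglyMeasurable)
        (Eventually.of_forall fun z => Eventually.of_forall fun y => ?_) (hκi.const_mul _)
        (Eventually.of_forall fun y => ?_)
      · have hk : 0 ≤ T * fejerKernel (T * y) := mul_nonneg hT.le (fejerKernel_nonneg _)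
        rw [norm_mul, Real.norm_of_nonneg hk]
        exact mul_le_mul_of_nonneg_right (hbound _) hk
      · simpa [← sub_eq_add_neg] using
          (hΔ0.comp (tendsto_atBot_add_const_right _ (-y) tendsto_id)).mul_const
          (T * fejerKernel (T * y))
    rw [integral_zero] at h0
    have h1 := (h0.const_sub (∫ y, Δ (z - y) * (T * fejerKernel (T * y)))).abs
    rw [sub_zero] at h1
    refine le_of_tendsto h1 ?_
    filter_upwards [eventually_le_atBot z] with z₀ hz₀
    exact hinc z₀ z hz₀
  -- `η` is the supremum of `|Δ|`; both `Δ` and `-Δ`, reflected, satisfy the one-sided bound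
  set B := (4 * ∫ t in (0 : ℝ)..T, b t) / J with hB
  have hBJ : B * J = 4 * ∫ t in (0 : ℝ)..T, b t := div_mul_cancel₀ _ hJ0.ne'
  set η := ⨆ x, |Δ x| with hη
  have hbdd : BddAbove (Set.range fun x => |Δ x|) := ⟨_, by rintro _ ⟨x, rfl⟩; exact hbound x⟩
  have hle : ∀ x, |Δ x| ≤ η := fun x => le_ciSup hbdd x
  have hup : ∀ x, Δ x ≤ 2 * m * A / T + 8 / 7 * B + η / 7 := fun x => by
    refine le_of_smoothed_le hΔm hle hm0 hT htail (fun h hh => ?_) (fun z => ?_)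
    · have h1 := hFmono (show x ≤ x + h by linarith)
      have h2 := (abs_le.1 (hGlip x (x + h) (by linarith))).2
      simp only [hΔ]
      have : m * (x + h - x) = m * h := by ring
      linarith
    · rw [← hJ, hBJ]; exact hsm z
  have hdown : ∀ x, -Δ x ≤ 2 * m * A / T + 8 / 7 * B + η / 7 := fun x => by
    have := le_of_smoothed_le (Δ := fun y => -Δ (-y)) (x₀ := -x) (η := η) (m := m) (T := T) (A := A)
      (B := B) (hΔm.comp measurable_neg).neg (fun y => by rw [abs_neg]; exact hle _) hm0 hT htail
      (fun h hh => ?_) (fun z => ?_)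
    · simpa using this
    · have h1 := hFmono (show x - h ≤ x by linarith)
      have h2 := (abs_le.1 (hGlip (x - h) x (by linarith))).2
      simp only [hΔ]
      have e1 : -(-x + h) = x - h := by ring
      rw [neg_neg, e1]
      have : m * (x - (x - h)) = m * h := by ring
      linarith
    · rw [← hJ, hBJ]
      have h1 : ∫ y, -Δ (-(z - y)) * (T * fejerKernel (T * y)) =
          -∫ y, Δ (-z - y) * (T * fejerKernel (T * y)) := by
        rw [← integral_neg, ← integral_neg_eq_self]
        congr 1; ext y
        have h2 : fejerKernel (T * -y) = fejerKernel (T * y) := by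
          simp [fejerKernel]
        have h3 : -(z - -y) = -z - y := by ring
        rw [h2, h3]; ring
      rw [h1, abs_neg]; exact hsm _
  have hηle : η ≤ 2 * m * A / T + 8 / 7 * B + η / 7 := ciSup_le fun x => abs_le.2
    ⟨by linarith [hdown x], hup x⟩
  intro z
  have hz : |ν.real (Set.Iic z) - ∫ x in Set.Iic z, q x| ≤ η := by rw [← hFreal]; exact hle z
  have hI : 0 ≤ ∫ t in (0 : ℝ)..T, b t := by
    have := (abs_nonneg _).trans (hsm 0); linarith
  have hmT : 0 ≤ m / T := by positivity
  have hexp : (3 * A + 6 / J) * ((∫ t in (0 : ℝ)..T, b t) + m / T) =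
      3 * (m * A / T) + 6 / 4 * B + (3 * A * (∫ t in (0 : ℝ)..T, b t) + 6 / J * (m / T)) := by
    rw [hB]; field_simp; ring
  have hrest : 0 ≤ 3 * A * (∫ t in (0 : ℝ)..T, b t) + 6 / J * (m / T) := by positivity
  have hB0 : 0 ≤ B := by positivity
  have hmA : 0 ≤ m * A / T := by positivity
  have : 2 * m * A / T = 2 * (m * A / T) := by ring
  rw [hexp]
  linarith

/-! ### Taylor expansion and decay of characteristic functions -/

lemma norm_cexp_mul_I_sub_taylor_le (x : ℝ) (N : ℕ) :
    ‖Complex.exp (x * Complex.I) - ∑ j ∈ Finset.range N, (x * Complex.I) ^ j / j.factorial‖ ≤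
      4 * |x| ^ N := by
  have hnorm : ‖(x : ℂ) * Complex.I‖ = |x| := by simp
  have hexp1 := Real.exp_one_lt_d9
  rcases le_or_gt |x| 1 with h | h
  · have h1 := Complex.norm_exp_sub_sum_le_norm_mul_exp (x * Complex.I) N
    rw [hnorm] at h1
    refine h1.trans ?_
    have h2 : Real.exp |x| ≤ Real.exp 1 := Real.exp_le_exp.2 h
    have h3 : 0 ≤ |x| ^ N := by positivity
    nlinarith
  · have h1 : ‖∑ j ∈ Finset.range N, (x * Complex.I) ^ j / (j.factorial : ℂ)‖ ≤
        |x| ^ N * Real.exp 1 := by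
      refine (norm_sum_le _ _).trans ?_
      calc ∑ j ∈ Finset.range N, ‖(x * Complex.I) ^ j / (j.factorial : ℂ)‖
          ≤ ∑ j ∈ Finset.range N, |x| ^ N * (1 ^ j / j.factorial) := by
            refine Finset.sum_le_sum fun j hj => ?_
            rw [norm_div, norm_pow, hnorm, Complex.norm_natCast, one_pow, mul_one_div]
            gcongr
            · exact h.le
            · exact (Finset.mem_range.1 hj).le
        _ ≤ _ := by
            rw [← Finset.mul_sum]
            gcongr
            exact Real.sum_le_exp_of_nonneg zero_le_one N
    have h2 : (1 : ℝ) ≤ |x| ^ N := one_le_pow₀ h.le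
    refine (norm_sub_le _ _).trans ?_
    rw [norm_cexp_mul_I]
    nlinarith

/-- The Taylor polynomial of the characteristic function, as a polynomial in `i u`. -/
noncomputable def momentPoly (ρ : Measure ℝ) (N : ℕ) : Polynomial ℝ :=
  ∑ j ∈ Finset.range N, Polynomial.monomial j ((∫ x, x ^ j ∂ρ) / j.factorial)

lemma coeff_momentPoly (ρ : Measure ℝ) {N j : ℕ} (hj : j < N) :
    (momentPoly ρ N).coeff j = (∫ x, x ^ j ∂ρ) / j.factorial := by
  simp only [momentPoly, Polynomial.finsetSum_coeff, Polynomial.coeff_monomial]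
  rw [Finset.sum_eq_single_of_mem j (Finset.mem_range.2 hj)]
  · simp
  · intro k _ hk; rw [if_neg hk]

lemma MeasureTheory.MemLp.integrable_pow_le {ρ : Measure ℝ} [IsFiniteMeasure ρ] {N j : ℕ}
    (h : MemLp id (N : ENNReal) ρ) (hj : j ≤ N) : Integrable (fun x => x ^ j) ρ := by
  have h1 : MemLp id (j : ENNReal) ρ := h.mono_exponent (by exact_mod_cast hj)
  have h2 := h1.integrable_norm_pow'
  refine h2.mono' (by fun_prop) (Eventually.of_forall fun x => ?_)
  simp

lemma norm_charFun_sub_momentPoly_le {ρ : Measure ℝ} [IsProbabilityMeasure ρ] {N : ℕ}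
    (h : MemLp id (N : ENNReal) ρ) (u : ℝ) :
    ‖charFun ρ u - Polynomial.aeval (u * Complex.I : ℂ) (momentPoly ρ N)‖ ≤
      (4 * ∫ x, |x| ^ N ∂ρ) * |u| ^ N := by
  have hj : ∀ j ∈ Finset.range N,
      Integrable (fun x : ℝ => ((u * x : ℝ) * Complex.I) ^ j / (j.factorial : ℂ)) ρ := by
    intro j hj
    have hp : Integrable (fun x : ℝ => ((x ^ j : ℝ) : ℂ)) ρ :=
      (h.integrable_pow_le (Finset.mem_range.1 hj).le).ofReal
    refine (hp.const_mul ((u * Complex.I) ^ j / j.factorial)).congr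
      (Eventually.of_forall fun x => ?_)
    push_cast; ring
  have h1 : Polynomial.aeval (u * Complex.I : ℂ) (momentPoly ρ N) =
      ∫ x, ∑ j ∈ Finset.range N, ((u * x : ℝ) * Complex.I) ^ j / (j.factorial : ℂ) ∂ρ := by
    rw [integral_finsetSum _ hj, momentPoly, map_sum]
    refine Finset.sum_congr rfl fun j _ => ?_
    rw [Polynomial.aeval_monomial, Complex.coe_algebraMap, Complex.ofReal_div,
      ← integral_complex_ofReal, div_mul_eq_mul_div, ← integral_mul_const, ← integral_div]
    congr 1; ext x; push_cast; ring
  have hi : Integrable (fun x => Complex.exp ((u * x : ℝ) * Complex.I)) ρ := by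
    refine (integrable_const (1 : ℝ)).mono' (Continuous.aestronglyMeasurable (by fun_prop))
      (Eventually.of_forall fun x => (norm_cexp_mul_I _).le)
  have h2 : charFun ρ u = ∫ x, Complex.exp ((u * x : ℝ) * Complex.I) ∂ρ := by
    rw [charFun_apply_real]; simp
  have habs : Integrable (fun x => |x| ^ N) ρ :=
    (h.integrable_pow_le le_rfl).norm.congr (Eventually.of_forall fun x => by simp)
  rw [h1, h2, ← integral_sub hi (integrable_finsetSum _ hj)]
  refine (norm_integral_le_of_norm_le ((habs.const_mul 4).mul_const (|u| ^ N))
    (Eventually.of_forall fun x => ?_)).trans_eq ?_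
  · refine (norm_cexp_mul_I_sub_taylor_le (u * x) N).trans_eq ?_
    rw [abs_mul, mul_pow]; ring
  · rw [integral_mul_const, integral_const_mul]

/-- The Taylor polynomial of `exp (u² / 2)`, as a polynomial in `i u`. -/
noncomputable def expSqPoly (N : ℕ) : Polynomial ℝ :=
  ∑ j ∈ Finset.range N, Polynomial.monomial (2 * j) ((-(1 / 2)) ^ j / j.factorial : ℝ)

lemma coeff_expSqPoly (N k : ℕ) :
    (expSqPoly N).coeff k = ∑ j ∈ Finset.range N,
      if 2 * j = k then ((-(1 / 2)) ^ j / j.factorial : ℝ) else 0 := by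
  simp only [expSqPoly, Polynomial.finsetSum_coeff, Polynomial.coeff_monomial]

lemma norm_cexp_sq_sub_expSqPoly_le (N : ℕ) {u : ℝ} (hu : |u| ≤ 1) :
    ‖Complex.exp ((u ^ 2 / 2 : ℝ) : ℂ) - Polynomial.aeval (u * Complex.I : ℂ) (expSqPoly N)‖ ≤
      4 * |u| ^ N := by
  have h1 : Polynomial.aeval (u * Complex.I : ℂ) (expSqPoly N) =
      ∑ j ∈ Finset.range N, ((u ^ 2 / 2 : ℝ) : ℂ) ^ j / j.factorial := by
    rw [expSqPoly, map_sum]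
    refine Finset.sum_congr rfl fun j _ => ?_
    rw [Polynomial.aeval_monomial, pow_mul, mul_pow, Complex.I_sq, Complex.coe_algebraMap]
    push_cast
    rw [div_mul_eq_mul_div, ← mul_pow]
    congr 2; ring
  rw [h1]
  refine (Complex.norm_exp_sub_sum_le_norm_mul_exp _ N).trans ?_
  have h2 : u ^ 2 ≤ |u| := by rw [← sq_abs]; nlinarith [abs_nonneg u]
  have h3 : ‖((u ^ 2 / 2 : ℝ) : ℂ)‖ ≤ |u| := by
    rw [Complex.norm_real, Real.norm_of_nonneg (by positivity)]; nlinarith [abs_nonneg u]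
  rw [mul_comm]
  have h4 : Real.exp ‖((u ^ 2 / 2 : ℝ) : ℂ)‖ ≤ 4 :=
    (Real.exp_le_exp.2 (h3.trans hu)).trans (by have := Real.exp_one_lt_d9; linarith)
  gcongr

lemma Polynomial.norm_aeval_le_const_mul_exp_sq (P : Polynomial ℝ) {c : ℝ} (hc : 0 < c) :
    ∃ C : ℝ, 0 < C ∧ ∀ z : ℂ, ‖Polynomial.aeval z P‖ ≤ C * Real.exp (c * ‖z‖ ^ 2) := by
  obtain ⟨C, hC, h⟩ := (P.map (algebraMap ℝ ℂ)).norm_eval_le_const_mul_exp_sq hc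
  exact ⟨C, hC, fun z => by simpa using h z⟩

/-- For a centred law of variance one, `ψ(u) exp (u² / 2)` is `1 + O(u³)`, with an expansion in
powers of `i u` with real coefficients. -/
lemma exists_charFun_mul_exp_expansion {ρ : Measure ℝ} [IsProbabilityMeasure ρ] {N : ℕ}
    (h : MemLp id (N : ENNReal) ρ) (hN : 3 ≤ N) (h1 : ∫ x, x ∂ρ = 0) (h2 : ∫ x, x ^ 2 ∂ρ = 1) :
    ∃ V : Polynomial ℝ, ∃ M : ℝ, 0 < M ∧ ∀ u : ℝ, |u| ≤ 1 →
      ‖charFun ρ u * Complex.exp ((u ^ 2 / 2 : ℝ) : ℂ) -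
        (1 + (u * Complex.I) ^ 3 * Polynomial.aeval (u * Complex.I : ℂ) V)‖ ≤ M * |u| ^ N := by
  set P := momentPoly ρ N with hP
  set Q := expSqPoly N with hQ
  -- the product of the Taylor polynomials is `1 + O(X³)`, by the normalisation of the moments
  have hdvd : Polynomial.X ^ 3 ∣ P * Q - 1 := by
    rw [Polynomial.X_pow_dvd_iff]
    have p0 : P.coeff 0 = 1 := by rw [hP, coeff_momentPoly ρ (by omega)]; simp
    have p1 : P.coeff 1 = 0 := by rw [hP, coeff_momentPoly ρ (by omega)]; simp [h1]
    have p2 : P.coeff 2 = 1 / 2 := by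
      rw [hP, coeff_momentPoly ρ (by omega), h2]; norm_num [Nat.factorial]
    obtain ⟨N', rfl⟩ : ∃ N', N = N' + 2 := ⟨N - 2, by omega⟩
    have hz : ∀ k < 3, ∀ j : ℕ, ¬ 2 * (j + 1 + 1) = k := fun k hk j => by omega
    have q0 : Q.coeff 0 = 1 := by
      rw [hQ, coeff_expSqPoly, Finset.sum_range_succ', Finset.sum_range_succ']; simp
    have q1 : Q.coeff 1 = 0 := by
      rw [hQ, coeff_expSqPoly, Finset.sum_range_succ', Finset.sum_range_succ']
      simp [hz 1 (by norm_num)]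
    have q2 : Q.coeff 2 = -(1 / 2) := by
      rw [hQ, coeff_expSqPoly, Finset.sum_range_succ', Finset.sum_range_succ']
      simp [hz 2 (by norm_num)]
    intro k hk
    rw [Polynomial.coeff_sub, Polynomial.coeff_one]
    interval_cases k
    · simp [Polynomial.mul_coeff_zero, p0, q0]
    · simp [Polynomial.mul_coeff_one, p0, q0, p1, q1]
    · rw [Polynomial.coeff_mul, Finset.Nat.sum_antidiagonal_eq_sum_range_succ_mk]
      simp [Finset.sum_range_succ, p0, q0, p1, q1, p2, q2]
  obtain ⟨V, hV⟩ := hdvd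
  obtain ⟨C, hC, hPC⟩ := P.norm_aeval_le_const_mul_exp_sq one_pos
  have hm : 0 ≤ ∫ x, |x| ^ N ∂ρ := integral_nonneg fun x => by positivity
  set m := 4 * ∫ x, |x| ^ N ∂ρ with hmdef
  have hm' : 0 ≤ m := by positivity
  refine ⟨V, m * 4 + C * 4 * 4, by positivity, fun u hu => ?_⟩
  have e1 : 1 + (u * Complex.I) ^ 3 * Polynomial.aeval (u * Complex.I : ℂ) V =
      Polynomial.aeval (u * Complex.I : ℂ) P * Polynomial.aeval (u * Complex.I : ℂ) Q := by
    have := congrArg (Polynomial.aeval (u * Complex.I : ℂ)) hV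
    simp only [map_sub, map_mul, map_one, map_pow, Polynomial.aeval_X] at this
    rw [← this]; ring
  have hexp := Real.exp_one_lt_d9
  have hu2 : u ^ 2 ≤ 1 := by rw [← sq_abs]; nlinarith [abs_nonneg u]
  have e2 : ‖Complex.exp ((u ^ 2 / 2 : ℝ) : ℂ)‖ ≤ 4 := by
    rw [Complex.norm_exp_ofReal]
    exact (Real.exp_le_exp.2 (show u ^ 2 / 2 ≤ 1 by linarith)).trans (by linarith)
  have e3 : ‖Polynomial.aeval (u * Complex.I : ℂ) P‖ ≤ C * 4 := by
    refine (hPC _).trans ?_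
    have : ‖(u : ℂ) * Complex.I‖ = |u| := by simp
    rw [this, sq_abs, one_mul]
    gcongr
    exact (Real.exp_le_exp.2 hu2).trans (by linarith)
  calc _ = ‖(charFun ρ u - Polynomial.aeval (u * Complex.I : ℂ) P) *
          Complex.exp ((u ^ 2 / 2 : ℝ) : ℂ) + Polynomial.aeval (u * Complex.I : ℂ) P *
          (Complex.exp ((u ^ 2 / 2 : ℝ) : ℂ) - Polynomial.aeval (u * Complex.I : ℂ) Q)‖ := by
        rw [e1]; congr 1; ring
    _ ≤ m * |u| ^ N * 4 + C * 4 * (4 * |u| ^ N) := by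
        refine (norm_add_le _ _).trans ?_
        rw [norm_mul, norm_mul]
        gcongr
        · exact norm_charFun_sub_momentPoly_le h u
        · exact norm_cexp_sq_sub_expSqPoly_le N hu
    _ = _ := by ring

lemma re_cexp_mul_charFun {ρ : Measure ℝ} [IsProbabilityMeasure ρ] (s β : ℝ) :
    (Complex.exp ((-β : ℝ) * Complex.I) * charFun ρ s).re = ∫ x, Real.cos (s * x - β) ∂ρ := by
  have hi : Integrable (fun x : ℝ => Complex.exp (s * x * Complex.I)) ρ := by
    refine (integrable_const (1 : ℝ)).mono' (Continuous.aestronglyMeasurable (by fun_prop))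
      (Eventually.of_forall fun x => ?_)
    rw [← Complex.ofReal_mul, norm_cexp_mul_I]
  rw [charFun_apply_real, ← integral_const_mul, ← Complex.reCLM_apply,
    ← ContinuousLinearMap.integral_comp_comm _ (hi.const_mul _)]
  congr 1; ext x
  rw [Complex.reCLM_apply, ← Complex.exp_add, ← add_mul, ← Complex.ofReal_mul,
    ← Complex.ofReal_add, Complex.exp_ofReal_mul_I_re]
  congr 1; ring

/-- Rotating by the argument of `φ(s)` makes the characteristic function at `s` real and
nonnegative. -/
lemma norm_charFun_eq_integral_cos {ρ : Measure ℝ} [IsProbabilityMeasure ρ] (s : ℝ) :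
    ‖charFun ρ s‖ = ∫ x, Real.cos (s * x - (charFun ρ s).arg) ∂ρ := by
  rw [← re_cexp_mul_charFun]
  conv_rhs => enter [1, 2]; rw [← Complex.norm_mul_exp_arg_mul_I (charFun ρ s)]
  rw [mul_left_comm, ← Complex.exp_add, ← add_mul, ← Complex.ofReal_add]
  simp

/-- The doubling inequality, from `1 - cos 2θ ≤ 4 (1 - cos θ)`. -/
lemma one_sub_norm_charFun_two_mul_le {ρ : Measure ℝ} [IsProbabilityMeasure ρ] (s : ℝ) :
    1 - ‖charFun ρ (2 * s)‖ ≤ 4 * (1 - ‖charFun ρ s‖) := by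
  set α := (charFun ρ s).arg with hα
  have hcos : ∀ s β : ℝ, Integrable (fun x : ℝ => Real.cos (s * x - β)) ρ := fun s β =>
    (integrable_const (1 : ℝ)).mono' (Continuous.aestronglyMeasurable (by fun_prop))
      (Eventually.of_forall fun x => Real.abs_cos_le_one _)
  have h1 : ‖charFun ρ s‖ = ∫ x, Real.cos (s * x - α) ∂ρ := norm_charFun_eq_integral_cos s
  have h2 : ∫ x, Real.cos (2 * s * x - 2 * α) ∂ρ ≤ ‖charFun ρ (2 * s)‖ := by
    rw [← re_cexp_mul_charFun]
    refine (Complex.re_le_norm _).trans ?_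
    rw [norm_mul, norm_cexp_mul_I, one_mul]
  have h3 : ∫ x, (4 * Real.cos (s * x - α) - 3) ∂ρ ≤ ∫ x, Real.cos (2 * s * x - 2 * α) ∂ρ := by
    refine integral_mono (((hcos _ _).const_mul 4).sub (integrable_const _)) (hcos _ _) fun x => ?_
    have : 2 * s * x - 2 * α = 2 * (s * x - α) := by ring
    simp only [this, Real.cos_two_mul]
    nlinarith [sq_nonneg (Real.cos (s * x - α) - 1)]
  rw [integral_sub ((hcos _ _).const_mul 4) (integrable_const _), integral_const_mul, ← h1] at h3
  simp at h3
  linarith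

/-- A bound `|φ| ≤ 1 - K / |s|^γ` at infinity implies a Gaussian bound near the origin, by the
doubling inequality `1 - |φ(2s)| ≤ 4 (1 - |φ(s)|)`. -/
lemma exists_norm_charFun_le_exp {ρ : Measure ℝ} [IsProbabilityMeasure ρ] {K γ : ℝ} (hK : 0 < K)
    (hγ : 0 ≤ γ) (h : ∀ s : ℝ, 1 < |s| → ‖charFun ρ s‖ ≤ 1 - K / |s| ^ γ) :
    ∃ c : ℝ, 0 < c ∧ ∀ s : ℝ, |s| ≤ 1 → ‖charFun ρ s‖ ≤ Real.exp (-c * s ^ 2) := by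
  refine ⟨K / 2 ^ γ / 4, by positivity, fun s hs => ?_⟩
  rcases eq_or_ne s 0 with rfl | hs0
  · simp
  have hpos : 0 < |s| := abs_pos.2 hs0
  have hiter : ∀ m : ℕ, 1 - ‖charFun ρ (2 ^ m * s)‖ ≤ 4 ^ m * (1 - ‖charFun ρ s‖) := by
    intro m
    induction m with
    | zero => simp
    | succ m ih =>
      have := one_sub_norm_charFun_two_mul_le (ρ := ρ) (2 ^ m * s)
      rw [← mul_assoc, ← pow_succ'] at this
      rw [pow_succ' 4]
      linarith
  -- double `s` until it lies in `(1, 2]`, where the bound at infinity applies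
  obtain ⟨m, hm1, hm2⟩ : ∃ m : ℕ, 1 < 2 ^ m * |s| ∧ 2 ^ m * |s| ≤ 2 := by
    obtain ⟨m, hm1, hm2⟩ := exists_nat_pow_near ((one_le_div hpos).2 hs) (one_lt_two (α := ℝ))
    refine ⟨m + 1, (div_lt_iff₀ hpos).1 hm2, ?_⟩
    rw [pow_succ']
    have := (le_div_iff₀ hpos).1 hm1
    linarith
  have habs : |2 ^ m * s| = 2 ^ m * |s| := by rw [abs_mul, abs_of_pos (by positivity)]
  have h1 := h (2 ^ m * s) (by rwa [habs])
  rw [habs] at h1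
  have h2 : K / 2 ^ γ ≤ K / (2 ^ m * |s|) ^ γ := by gcongr
  have h3 := hiter m
  have h4 : (4 : ℝ) ^ m * s ^ 2 ≤ 4 := by
    have : (4 : ℝ) ^ m * s ^ 2 = (2 ^ m * |s|) ^ 2 := by
      rw [mul_pow, sq_abs, ← pow_mul, mul_comm m, pow_mul]; norm_num
    rw [this]; nlinarith
  have h5 : K / 2 ^ γ / 4 * s ^ 2 ≤ 1 - ‖charFun ρ s‖ := by
    have h6 : 0 < K / 2 ^ γ := by positivity
    have h7 : K / 2 ^ γ ≤ 4 ^ m * (1 - ‖charFun ρ s‖) := by linarith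
    have h8 : (0 : ℝ) < 4 ^ m := by positivity
    rw [← mul_le_mul_iff_right₀ h8]
    nlinarith
  have := Real.add_one_le_exp (-(K / 2 ^ γ / 4) * s ^ 2)
  linarith

/-! ### Expansion of the powers of the characteristic function -/

lemma Complex.norm_pow_sub_pow_le {a b : ℂ} {r : ℝ} (ha : ‖a‖ ≤ r) (hb : ‖b‖ ≤ r) (n : ℕ) :
    ‖a ^ n - b ^ n‖ ≤ n * ‖a - b‖ * r ^ (n - 1) := by
  have hr : 0 ≤ r := (norm_nonneg _).trans ha
  rw [← (Commute.all a b).geom_sum₂_mul, norm_mul]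
  have h : ‖∑ i ∈ Finset.range n, a ^ i * b ^ (n - 1 - i)‖ ≤ n * r ^ (n - 1) := by
    refine (norm_sum_le_of_le _ (f := fun i => a ^ i * b ^ (n - 1 - i)) (n := fun _ => r ^ (n - 1))
      fun i hi => ?_).trans_eq (by simp)
    rw [norm_mul, norm_pow, norm_pow]
    calc ‖a‖ ^ i * ‖b‖ ^ (n - 1 - i) ≤ r ^ i * r ^ (n - 1 - i) := by gcongr
      _ = r ^ (n - 1) := by
        rw [← pow_add]; congr 1; have := Finset.mem_range.1 hi; omega
  calc _ ≤ n * r ^ (n - 1) * ‖a - b‖ := by gcongr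
    _ = _ := by ring

/-- The error of the truncated binomial expansion of `(1 + v) ^ n`. -/
lemma norm_one_add_pow_sub_sum_choose_le (v : ℂ) (n d : ℕ) :
    ‖(1 + v) ^ n - ∑ k ∈ Finset.range d, (n.choose k : ℂ) * v ^ k‖ ≤
      (n * ‖v‖) ^ d * Real.exp (n * ‖v‖) := by
  have h1 : (1 + v) ^ n = ∑ k ∈ Finset.range (d + (n + 1)), (n.choose k : ℂ) * v ^ k := by
    rw [add_comm, add_pow]
    refine Finset.sum_subset_zero_on_sdiff (Finset.range_mono (by omega)) (fun k hk => ?_)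
      (fun k _ => by rw [one_pow, mul_one, mul_comm])
    rw [Finset.mem_sdiff, Finset.mem_range, Finset.mem_range] at hk
    rw [Nat.choose_eq_zero_of_lt (by omega)]; simp
  rw [h1, Finset.sum_range_add, add_sub_cancel_left]
  have hnv : 0 ≤ n * ‖v‖ := by positivity
  refine (norm_sum_le _ _).trans ?_
  calc ∑ i ∈ Finset.range (n + 1), ‖(n.choose (d + i) : ℂ) * v ^ (d + i)‖
      ≤ ∑ i ∈ Finset.range (n + 1), (n * ‖v‖) ^ d * ((n * ‖v‖) ^ i / i.factorial) := by
        refine Finset.sum_le_sum fun i _ => ?_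
        rw [norm_mul, norm_pow, Complex.norm_natCast, ← mul_div_assoc, ← pow_add, mul_pow,
          mul_div_right_comm]
        gcongr
        refine (Nat.choose_le_pow_div (d + i) n).trans ?_
        gcongr
        omega
    _ ≤ _ := by
        rw [← Finset.mul_sum]
        gcongr
        exact Real.sum_le_exp_of_nonneg hnv _

/-- Evaluation of a polynomial in `x` whose coefficients are real polynomials in `τ`. -/
noncomputable def evalTwo (τ x : ℂ) : Polynomial (Polynomial ℝ) →+* ℂ :=
  Polynomial.eval₂RingHom (Polynomial.aeval τ : Polynomial ℝ →ₐ[ℝ] ℂ).toRingHom x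

lemma evalTwo_X (τ x : ℂ) : evalTwo τ x Polynomial.X = x := by simp [evalTwo]

lemma evalTwo_C (τ x : ℂ) (p : Polynomial ℝ) :
    evalTwo τ x (Polynomial.C p) = Polynomial.aeval τ p := by simp [evalTwo]

lemma exists_norm_evalTwo_sub_le (G : Polynomial (Polynomial ℝ)) (m : ℕ) {c : ℝ} (hc : 0 < c) :
    ∃ C : ℝ, 0 < C ∧ ∀ (τ : ℂ) (x : ℝ), 0 ≤ x → x ≤ 1 →
      ‖evalTwo τ x G - ∑ j ∈ Finset.range m, Polynomial.aeval τ (G.coeff j) * (x : ℂ) ^ j‖ ≤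
        x ^ m * (C * Real.exp (c * ‖τ‖ ^ 2)) := by
  choose C hC hb using fun j => (G.coeff j).norm_aeval_le_const_mul_exp_sq hc
  refine ⟨∑ i ∈ Finset.range (G.natDegree + 1), C (m + i),
    Finset.sum_pos (fun i _ => hC _) ⟨0, by simp⟩, fun τ x hx0 hx1 => ?_⟩
  have h1 : evalTwo τ x G = ∑ j ∈ Finset.range (m + (G.natDegree + 1)),
      Polynomial.aeval τ (G.coeff j) * (x : ℂ) ^ j := by
    rw [evalTwo, Polynomial.coe_eval₂RingHom,
      Polynomial.eval₂_eq_sum_range' _ (show G.natDegree < m + (G.natDegree + 1) by omega)]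
    rfl
  rw [h1, Finset.sum_range_add, add_sub_cancel_left]
  refine (norm_sum_le _ _).trans ?_
  rw [Finset.sum_mul, Finset.mul_sum]
  refine Finset.sum_le_sum fun i _ => ?_
  rw [norm_mul, norm_pow, Complex.norm_real, Real.norm_of_nonneg hx0, mul_comm]
  exact mul_le_mul (pow_le_pow_of_le_one hx0 hx1 (by omega)) (hb _ _) (norm_nonneg _)
    (by positivity)

/-- With `n x² = 1`, the binomial coefficient `C(n, k)` becomes a polynomial in `x`. -/
lemma choose_mul_pow_eq (n k : ℕ) {x : ℂ} (hx : n * x ^ 2 = 1) :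
    (n.choose k : ℂ) * x ^ (2 * k) =
      (k.factorial : ℂ)⁻¹ * ∏ i ∈ Finset.range k, (1 - i * x ^ 2) := by
  have h1 : (n.descFactorial k : ℂ) * x ^ (2 * k) = ∏ i ∈ Finset.range k, (1 - i * x ^ 2) := by
    have h0 : (x ^ 2) ^ k = ∏ _i ∈ Finset.range k, x ^ 2 := by simp
    rw [← descPochhammer_eval_eq_descFactorial, descPochhammer_eval_eq_prod_range, pow_mul, h0,
      ← Finset.prod_mul_distrib]
    refine Finset.prod_congr rfl fun i _ => ?_
    rw [sub_mul, hx]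
  have h2 : (k.factorial : ℂ) ≠ 0 := by exact_mod_cast k.factorial_ne_zero
  rw [← h1, Nat.descFactorial_eq_factorial_mul_choose]
  push_cast
  field_simp

/-- The truncated binomial expansion of `(1 + (xτ)³ V(xτ))ⁿ`, where `n x² = 1`, is a polynomial in
`x` and `τ`, equal to `1` for `x τ = 0`. -/
lemma exists_evalTwo_eq_sum_choose (V : Polynomial ℝ) {d : ℕ} (hd : 1 ≤ d) :
    ∃ G : Polynomial (Polynomial ℝ), ∀ (n : ℕ) (x τ : ℂ), n * x ^ 2 = 1 →
      ∑ k ∈ Finset.range d, (n.choose k : ℂ) *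
        ((x * τ) ^ 3 * Polynomial.aeval (x * τ) V) ^ k = 1 + x * τ * evalTwo τ x G := by
  set Y : Polynomial (Polynomial ℝ) := Polynomial.C Polynomial.X with hY
  set W : Polynomial (Polynomial ℝ) :=
    V.eval₂ (Polynomial.C.comp Polynomial.C) (Polynomial.X * Y) with hW
  set B : ℕ → Polynomial (Polynomial ℝ) := fun k =>
    Polynomial.C (Polynomial.C (k.factorial : ℝ)⁻¹) *
      (∏ i ∈ Finset.range k, (1 - (i : Polynomial (Polynomial ℝ)) * Polynomial.X ^ 2)) *
      (Polynomial.X * Y * (Y ^ 2 * W)) ^ k with hB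
  obtain ⟨d, rfl⟩ : ∃ d', d = d' + 1 := ⟨d - 1, by omega⟩
  have hdvd : Polynomial.X * Y ∣ ∑ k ∈ Finset.range d, B (k + 1) :=
    Finset.dvd_sum fun k _ => Dvd.dvd.mul_left (dvd_pow (Dvd.intro _ rfl) (Nat.succ_ne_zero k)) _
  obtain ⟨G, hG⟩ := hdvd
  refine ⟨G, fun n x τ hx => ?_⟩
  have hYe : evalTwo τ x Y = τ := by rw [hY, evalTwo_C, Polynomial.aeval_X]
  have hWe : evalTwo τ x W = Polynomial.aeval (x * τ) V := by
    rw [hW, Polynomial.hom_eval₂, map_mul, evalTwo_X, hYe, Polynomial.aeval_def]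
    congr 1
    ext r
    simp [evalTwo]
  have hBe : ∀ k, evalTwo τ x (B k) = (n.choose k : ℂ) *
      ((x * τ) ^ 3 * Polynomial.aeval (x * τ) V) ^ k := fun k => by
    simp only [hB, map_mul, map_prod, map_sub, map_one, map_natCast, map_pow, evalTwo_X, hYe, hWe,
      evalTwo_C]
    have h1 := choose_mul_pow_eq n k hx
    rw [Polynomial.aeval_C, Complex.coe_algebraMap, Complex.ofReal_inv, Complex.ofReal_natCast,
      ← h1, mul_assoc, pow_mul, ← mul_pow]
    congr 2; ring
  rw [← Finset.sum_congr rfl fun k _ => hBe k, ← map_sum, Finset.sum_range_succ', hG, map_add,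
    map_mul, map_mul, evalTwo_X, hYe]
  simp [hB, add_comm]

/-- The Fourier transform of an Edgeworth series whose polynomials are dual to
`g 0, g 1, …, g (r - 1)`, with `x` in the place of `n^{-1/2}`. -/
noncomputable def edgeworthFourier (g : ℕ → Polynomial ℝ) (r : ℕ) (x t : ℝ) : ℂ :=
  Complex.exp ((-(t ^ 2 / 2) : ℝ) : ℂ) * (1 + x * (t * Complex.I) *
    ∑ k ∈ Finset.range r, Polynomial.aeval (t * Complex.I : ℂ) (g k) * (x : ℂ) ^ k)

lemma norm_ofReal_mul_I (t : ℝ) : ‖(t : ℂ) * Complex.I‖ = |t| := by simp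

lemma exists_norm_edgeworthFourier_le (g : ℕ → Polynomial ℝ) (r : ℕ) :
    ∃ C : ℝ, 0 < C ∧ ∀ x t : ℝ, 0 ≤ x → x ≤ 1 →
      ‖edgeworthFourier g r x t‖ ≤ C * Real.exp (-(1 / 4) * t ^ 2) := by
  choose D hD hb using fun k =>
    (Polynomial.X * g k).norm_aeval_le_const_mul_exp_sq (c := 1 / 4) (by norm_num)
  refine ⟨1 + ∑ k ∈ Finset.range r, D k,
    add_pos_of_pos_of_nonneg one_pos (Finset.sum_nonneg fun k _ => (hD k).le),
    fun x t hx0 hx1 => ?_⟩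
  have h1 : ‖(1 : ℂ) + x * (t * Complex.I) *
      ∑ k ∈ Finset.range r, Polynomial.aeval (t * Complex.I : ℂ) (g k) * (x : ℂ) ^ k‖ ≤
      (1 + ∑ k ∈ Finset.range r, D k) * Real.exp (1 / 4 * t ^ 2) := by
    refine (norm_add_le _ _).trans ?_
    rw [add_mul, one_mul, norm_one, Finset.mul_sum, Finset.sum_mul]
    refine add_le_add (Real.one_le_exp (by positivity)) ((norm_sum_le _ _).trans ?_)
    refine Finset.sum_le_sum fun k _ => ?_
    have h2 := hb k (t * Complex.I)
    rw [norm_ofReal_mul_I, sq_abs, map_mul, Polynomial.aeval_X] at h2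
    have h3 : (x : ℂ) * (t * Complex.I) * (Polynomial.aeval (t * Complex.I : ℂ) (g k) * (x : ℂ) ^ k)
        = ((x ^ (k + 1) : ℝ) : ℂ) *
          (t * Complex.I * Polynomial.aeval (t * Complex.I : ℂ) (g k)) := by
      push_cast; ring
    rw [h3, norm_mul, Complex.norm_real, Real.norm_of_nonneg (by positivity)]
    calc _ ≤ 1 * (D k * Real.exp (1 / 4 * t ^ 2)) := by
          gcongr
          exact pow_le_one₀ hx0 hx1
      _ = _ := one_mul _
  rw [edgeworthFourier, norm_mul, Complex.norm_exp_ofReal]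
  calc _ ≤ Real.exp (-(t ^ 2 / 2)) *
        ((1 + ∑ k ∈ Finset.range r, D k) * Real.exp (1 / 4 * t ^ 2)) := by gcongr
    _ = (1 + ∑ k ∈ Finset.range r, D k) *
        (Real.exp (-(t ^ 2 / 2)) * Real.exp (1 / 4 * t ^ 2)) := by ring
    _ = _ := by rw [← Real.exp_add]; congr 2; ring

/-- Near the origin, the power of the characteristic function is compared with the power of its
Taylor polynomial. -/
lemma norm_pow_sub_pow_taylor_le {p v : ℂ} {u M c : ℝ} {N n : ℕ} (hn : 2 ≤ n) (hc0 : 0 < c)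
    (hc : c ≤ 1 / 4) (hp : ‖p‖ ≤ Real.exp (-c * u ^ 2)) (hv : ‖v‖ ≤ u ^ 2 / 4)
    (hpv : ‖p * Complex.exp ((u ^ 2 / 2 : ℝ) : ℂ) - (1 + v)‖ ≤ M * |u| ^ N) :
    ‖p ^ n - Complex.exp ((-(n * u ^ 2 / 2) : ℝ) : ℂ) * (1 + v) ^ n‖ ≤
      n * (M * |u| ^ N) * Real.exp (-(c / 2) * (n * u ^ 2)) := by
  set b : ℂ := Complex.exp ((-(u ^ 2 / 2) : ℝ) : ℂ) * (1 + v) with hb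
  have e1 : Complex.exp ((-(n * u ^ 2 / 2) : ℝ) : ℂ) * (1 + v) ^ n = b ^ n := by
    rw [hb, mul_pow, ← Complex.exp_nat_mul]
    congr 2; push_cast; ring
  have e2 : p - b = Complex.exp ((-(u ^ 2 / 2) : ℝ) : ℂ) *
      (p * Complex.exp ((u ^ 2 / 2 : ℝ) : ℂ) - (1 + v)) := by
    have : Complex.exp ((-(u ^ 2 / 2) : ℝ) : ℂ) * Complex.exp ((u ^ 2 / 2 : ℝ) : ℂ) = 1 := by
      rw [← Complex.exp_add, ← Complex.ofReal_add]; simp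
    rw [hb, mul_sub, mul_left_comm, this, mul_one]
  have hb1 : ‖b‖ ≤ Real.exp (-c * u ^ 2) := by
    rw [hb, norm_mul, Complex.norm_exp_ofReal]
    have h1 : ‖1 + v‖ ≤ Real.exp (u ^ 2 / 4) := by
      refine (norm_add_le _ _).trans ?_
      rw [norm_one]
      have := Real.add_one_le_exp (u ^ 2 / 4)
      linarith
    calc _ ≤ Real.exp (-(u ^ 2 / 2)) * Real.exp (u ^ 2 / 4) := by gcongr
      _ = Real.exp (-(1 / 4) * u ^ 2) := by rw [← Real.exp_add]; congr 1; ring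
      _ ≤ _ := Real.exp_le_exp.2 (by nlinarith [sq_nonneg u])
  have hpb : ‖p - b‖ ≤ M * |u| ^ N := by
    rw [e2, norm_mul, Complex.norm_exp_ofReal]
    have : Real.exp (-(u ^ 2 / 2)) ≤ 1 := Real.exp_le_one_iff.2 (by nlinarith [sq_nonneg u])
    calc _ ≤ 1 * (M * |u| ^ N) := by gcongr
      _ = _ := one_mul _
  rw [e1]
  refine (Complex.norm_pow_sub_pow_le hp hb1 n).trans ?_
  have hM : 0 ≤ M * |u| ^ N := (norm_nonneg _).trans hpb
  rw [← Real.exp_nat_mul]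
  refine mul_le_mul (by gcongr) (Real.exp_le_exp.2 ?_) (Real.exp_pos _).le (by positivity)
  rw [Nat.cast_sub (by omega)]
  have : (2 : ℝ) ≤ n := by exact_mod_cast hn
  push_cast
  nlinarith [mul_nonneg hc0.le (sq_nonneg u)]

set_option maxHeartbeats 1000000 in
/-- The Fourier transform of the Edgeworth series approximates the characteristic function of the
normalised sum, with a Gaussian weight, for `|t| ≤ δ₀ √n`. -/
theorem exists_edgeworthFourier_approx {ψ : ℝ → ℂ} {d : ℕ} (hd : 1 ≤ d) {V : Polynomial ℝ}
    {M : ℝ} (hM : 0 < M)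
    (hV : ∀ u : ℝ, |u| ≤ 1 → ‖ψ u * Complex.exp ((u ^ 2 / 2 : ℝ) : ℂ) -
        (1 + (u * Complex.I) ^ 3 * Polynomial.aeval (u * Complex.I : ℂ) V)‖ ≤ M * |u| ^ (d + 2))
    {c δ₀ : ℝ} (hc : 0 < c) (hδ₀ : 0 < δ₀) (hψ : ∀ u, |u| ≤ δ₀ → ‖ψ u‖ ≤ Real.exp (-c * u ^ 2)) :
    ∃ (g : ℕ → Polynomial ℝ) (C c' : ℝ), 0 < C ∧ 0 < c' ∧ ∀ n : ℕ, 2 ≤ n → ∀ t : ℝ,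
      |t * (√n)⁻¹| ≤ δ₀ →
      ‖ψ (t * (√n)⁻¹) ^ n - edgeworthFourier g (d - 1) (√n)⁻¹ t‖ ≤
        C * (√n)⁻¹ ^ d * |t| * Real.exp (-c' * t ^ 2) := by
  obtain ⟨G, hG⟩ := exists_evalTwo_eq_sum_choose V hd
  obtain ⟨CG, hCG, hGb⟩ := exists_norm_evalTwo_sub_le G (d - 1) (c := 1 / 4) (by norm_num)
  obtain ⟨CV', hCV', hVb⟩ := V.norm_aeval_le_const_mul_exp_sq one_pos
  obtain ⟨CE, hCE, hEb⟩ := exists_norm_edgeworthFourier_le G.coeff (d - 1)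
  set CV := CV' * 4 with hCVdef
  have hCV : 0 < CV := by positivity
  set c₁ := min c (1 / 4) with hc₁
  have hc₁0 : 0 < c₁ := lt_min hc (by norm_num)
  have hc₁c : c₁ ≤ c := min_le_left _ _
  have hc₁4 : c₁ ≤ 1 / 4 := min_le_right _ _
  -- below `δ` the cubic remainder `v` satisfies `|v| ≤ u² / 4`, so that `n |v| ≤ t² / 4` is
  -- absorbed by the Gaussian factor
  set δ := min (min 1 δ₀) (1 / (4 * CV)) with hδ
  have hδ0 : 0 < δ := by positivity
  have hδ1 : δ ≤ 1 := (min_le_left _ _).trans (min_le_left _ _)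
  have hδδ₀ : δ ≤ δ₀ := (min_le_left _ _).trans (min_le_right _ _)
  have hδCV : CV * δ ≤ 1 / 4 := by
    have : δ ≤ 1 / (4 * CV) := min_le_right _ _
    rw [le_div_iff₀ (by positivity)] at this
    linarith
  obtain ⟨CA, hCA, hA⟩ := pow_le_const_mul_exp_sq (d + 1) (c := c₁ / 4) (by positivity)
  obtain ⟨CB, hCB, hB⟩ := pow_le_const_mul_exp_sq (3 * d - 1) (c := 1 / 8) (by norm_num)
  obtain ⟨CD, hCD, hD⟩ := pow_le_const_mul_exp_sq (d - 1) (c := c₁ / 2) (by positivity)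
  refine ⟨G.coeff, M * CA + CV ^ d * CB + CG + (1 + CE) * CD / δ ^ d, c₁ / 4, by positivity,
    by positivity, fun n hn t ht => ?_⟩
  set x := (√(n : ℝ))⁻¹ with hx
  have hn0 : (0 : ℝ) < n := by positivity
  have hx0 : 0 < x := by positivity
  have hnx : n * x ^ 2 = 1 := by
    rw [hx, inv_pow, Real.sq_sqrt hn0.le, mul_inv_cancel₀ hn0.ne']
  have hx1 : x ≤ 1 := by
    have : (1 : ℝ) ≤ n := by exact_mod_cast (by omega : 1 ≤ n)
    exact inv_le_one_of_one_le₀ (Real.one_le_sqrt.2 this)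
  set T := |t| with hT
  have hT0 : 0 ≤ T := abs_nonneg t
  have hT2 : t ^ 2 = T ^ 2 := (sq_abs t).symm
  set u := t * x with hu
  have hua : |u| = T * x := by rw [hu, abs_mul, abs_of_pos hx0]
  have hnu : n * u ^ 2 = T ^ 2 := by rw [hu, mul_pow, hT2]; linear_combination T ^ 2 * hnx
  have hTd : T ^ d = T * T ^ (d - 1) := by rw [← pow_succ']; congr 1; omega
  set R := x ^ d * T * Real.exp (-(c₁ / 4) * T ^ 2) with hR
  have hR0 : 0 ≤ R := by positivity
  have hexp : ∀ a, c₁ / 4 ≤ a → Real.exp (-a * T ^ 2) ≤ Real.exp (-(c₁ / 4) * T ^ 2) :=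
    fun a ha => Real.exp_le_exp.2 (by nlinarith [sq_nonneg T])
  have hgoal : (M * CA + CV ^ d * CB + CG + (1 + CE) * CD / δ ^ d) * x ^ d * T *
      Real.exp (-(c₁ / 4) * t ^ 2) =
      (M * CA * R + CV ^ d * CB * R + CG * R) + (1 + CE) * CD / δ ^ d * R := by
    rw [hR, hT2]; ring
  rw [hgoal]
  -- for `|u| ≤ δ` the expansion converges; for `|u| > δ` both terms are small and the factor
  -- `(T x / δ) ^ d ≥ 1` supplies the power of `x`
  rcases le_or_gt |u| δ with hle | hgt
  · refine le_trans ?_ (le_add_of_nonneg_right (by positivity))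
    set v := ((u : ℂ) * Complex.I) ^ 3 * Polynomial.aeval (u * Complex.I : ℂ) V with hv
    have hu1 : |u| ≤ 1 := hle.trans hδ1
    have hvC : ‖v‖ ≤ CV * |u| ^ 3 := by
      rw [hv, norm_mul, norm_pow, norm_ofReal_mul_I, mul_comm]
      gcongr
      refine (hVb _).trans ?_
      rw [norm_ofReal_mul_I, one_mul]
      have h1 : |u| ^ 2 ≤ 1 := pow_le_one₀ (abs_nonneg _) hu1
      have h2 := Real.exp_le_exp.2 h1
      have h3 := Real.exp_one_lt_d9
      exact mul_le_mul_of_nonneg_left (by linarith) hCV'.le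
    have hv4 : ‖v‖ ≤ u ^ 2 / 4 := by
      refine hvC.trans ?_
      rw [← sq_abs u]
      calc CV * |u| ^ 3 = CV * |u| * |u| ^ 2 := by ring
        _ ≤ CV * δ * |u| ^ 2 := by gcongr
        _ ≤ 1 / 4 * |u| ^ 2 := by gcongr
        _ = _ := by ring
    have hnv4 : n * ‖v‖ ≤ T ^ 2 / 4 := by
      calc n * ‖v‖ ≤ n * (u ^ 2 / 4) := by gcongr
        _ = _ := by rw [← hnu]; ring
    have hnvC : n * ‖v‖ ≤ CV * T ^ 3 * x := by
      calc n * ‖v‖ ≤ n * (CV * |u| ^ 3) := by gcongr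
        _ = CV * T ^ 3 * x * (n * x ^ 2) := by rw [hua]; ring
        _ = _ := by rw [hnx, mul_one]
    have hsum := hG n x (t * Complex.I) (by exact_mod_cast hnx)
    have hxt : (x : ℂ) * (t * Complex.I) = u * Complex.I := by rw [hu]; push_cast; ring
    rw [hxt, ← hv] at hsum
    set E : ℂ := Complex.exp ((-(t ^ 2 / 2) : ℝ) : ℂ) with hE
    have hEn : ‖E‖ = Real.exp (-(T ^ 2 / 2)) := by rw [hE, Complex.norm_exp_ofReal, hT2]
    have hEe : Complex.exp ((-(n * u ^ 2 / 2) : ℝ) : ℂ) = E := by rw [hnu, hE, hT2]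
    -- Taylor error, error of the truncated binomial series, and error of the truncation in `x`
    have hdecomp : ψ u ^ n - edgeworthFourier G.coeff (d - 1) x t =
        (ψ u ^ n - E * (1 + v) ^ n) +
        E * ((1 + v) ^ n - ∑ k ∈ Finset.range d, (n.choose k : ℂ) * v ^ k) +
        E * ((u * Complex.I) * (evalTwo (t * Complex.I) x G -
          ∑ j ∈ Finset.range (d - 1),
            Polynomial.aeval (t * Complex.I : ℂ) (G.coeff j) * (x : ℂ) ^ j)) := by
      rw [hsum, edgeworthFourier, hxt, ← hE]; ring
    rw [hdecomp]
    refine (norm_add_le _ _).trans (add_le_add ((norm_add_le _ _).trans (add_le_add ?_ ?_)) ?_)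
    · have h1 := norm_pow_sub_pow_taylor_le (p := ψ u) (v := v) (u := u) hn hc₁0 hc₁4
        ((hψ u (hle.trans hδδ₀)).trans (Real.exp_le_exp.2 (by nlinarith [sq_nonneg u]))) hv4
        (hV u hu1)
      rw [hEe, hnu, hua] at h1
      refine h1.trans ?_
      calc n * (M * (T * x) ^ (d + 2)) * Real.exp (-(c₁ / 2) * T ^ 2)
          = M * x ^ d * T * (n * x ^ 2) * (T ^ (d + 1) * Real.exp (-(c₁ / 2) * T ^ 2)) := by ring
        _ ≤ M * x ^ d * T * (n * x ^ 2) *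
            (CA * Real.exp (c₁ / 4 * T ^ 2) * Real.exp (-(c₁ / 2) * T ^ 2)) := by
            gcongr; exact hA T hT0
        _ = M * CA * R := by
            rw [hnx, mul_assoc CA, ← Real.exp_add, hR,
              show c₁ / 4 * T ^ 2 + -(c₁ / 2) * T ^ 2 = -(c₁ / 4) * T ^ 2 by ring]
            ring
    · rw [norm_mul, hEn]
      calc _ ≤ Real.exp (-(T ^ 2 / 2)) * ((n * ‖v‖) ^ d * Real.exp (n * ‖v‖)) := by
            gcongr; exact norm_one_add_pow_sub_sum_choose_le v n d
        _ ≤ Real.exp (-(T ^ 2 / 2)) * ((CV * T ^ 3 * x) ^ d * Real.exp (T ^ 2 / 4)) := by gcongr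
        _ = CV ^ d * x ^ d * T * T ^ (3 * d - 1) *
            (Real.exp (-(T ^ 2 / 2)) * Real.exp (T ^ 2 / 4)) := by
            have : (T ^ 3) ^ d = T * T ^ (3 * d - 1) := by
              rw [← pow_mul, ← pow_succ']; congr 1; omega
            rw [mul_pow, mul_pow, this]; ring
        _ ≤ CV ^ d * x ^ d * T * (CB * Real.exp (1 / 8 * T ^ 2)) *
            (Real.exp (-(T ^ 2 / 2)) * Real.exp (T ^ 2 / 4)) := by
            gcongr; exact hB T hT0
        _ = CV ^ d * CB * (x ^ d * T) * Real.exp (-(1 / 8) * T ^ 2) := by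
            rw [← Real.exp_add, ← mul_assoc, mul_assoc _ (Real.exp _) (Real.exp _), ← Real.exp_add,
              show 1 / 8 * T ^ 2 + (-(T ^ 2 / 2) + T ^ 2 / 4) = -(1 / 8) * T ^ 2 by ring]
            ring
        _ ≤ CV ^ d * CB * (x ^ d * T) * Real.exp (-(c₁ / 4) * T ^ 2) := by
            exact mul_le_mul_of_nonneg_left (hexp _ (by linarith)) (by positivity)
        _ = _ := by rw [hR]; ring
    · rw [norm_mul, hEn, norm_mul, norm_ofReal_mul_I, hua]
      have h1 := hGb (t * Complex.I) x hx0.le hx1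
      rw [norm_ofReal_mul_I, ← hT] at h1
      calc _ ≤ Real.exp (-(T ^ 2 / 2)) * (T * x *
            (x ^ (d - 1) * (CG * Real.exp (1 / 4 * T ^ 2)))) := by gcongr
        _ = CG * (x ^ d * T) * (Real.exp (-(T ^ 2 / 2)) * Real.exp (1 / 4 * T ^ 2)) := by
            have : x ^ d = x * x ^ (d - 1) := by rw [← pow_succ']; congr 1; omega
            rw [this]; ring
        _ = CG * (x ^ d * T) * Real.exp (-(1 / 4) * T ^ 2) := by
            rw [← Real.exp_add]; congr 2; ring
        _ ≤ CG * (x ^ d * T) * Real.exp (-(c₁ / 4) * T ^ 2) :=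
            mul_le_mul_of_nonneg_left (hexp _ (by linarith)) (by positivity)
        _ = _ := by rw [hR]; ring
  · refine le_trans ?_ (le_add_of_nonneg_left (by positivity))
    have h1 : ‖ψ u ^ n‖ ≤ Real.exp (-c₁ * T ^ 2) := by
      rw [norm_pow]
      calc ‖ψ u‖ ^ n ≤ Real.exp (-c * u ^ 2) ^ n := by gcongr; exact hψ u ht
        _ = Real.exp (-c * T ^ 2) := by rw [← Real.exp_nat_mul, ← hnu]; congr 1; ring
        _ ≤ _ := Real.exp_le_exp.2 (by nlinarith [sq_nonneg T])
    have h2 : ‖edgeworthFourier G.coeff (d - 1) x t‖ ≤ CE * Real.exp (-c₁ * T ^ 2) := by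
      refine (hEb x t hx0.le hx1).trans ?_
      rw [hT2]; gcongr
    have h3 : 1 ≤ (T * x / δ) ^ d := one_le_pow₀ (by rw [one_le_div hδ0, ← hua]; exact hgt.le)
    calc _ ≤ (1 + CE) * Real.exp (-c₁ * T ^ 2) * 1 := by
          refine (norm_sub_le _ _).trans ?_; linarith
      _ ≤ (1 + CE) * Real.exp (-c₁ * T ^ 2) * (T * x / δ) ^ d := by gcongr
      _ = (1 + CE) / δ ^ d * (x ^ d * T) * (T ^ (d - 1) * Real.exp (-c₁ * T ^ 2)) := by
          rw [div_pow, mul_pow, hTd]; ring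
      _ ≤ (1 + CE) / δ ^ d * (x ^ d * T) *
          (CD * Real.exp (c₁ / 2 * T ^ 2) * Real.exp (-c₁ * T ^ 2)) := by
          gcongr; exact hD T hT0
      _ = (1 + CE) * CD / δ ^ d * (x ^ d * T) * Real.exp (-(c₁ / 2) * T ^ 2) := by
          rw [mul_assoc CD, ← Real.exp_add,
            show c₁ / 2 * T ^ 2 + -c₁ * T ^ 2 = -(c₁ / 2) * T ^ 2 by ring]
          ring
      _ ≤ (1 + CE) * CD / δ ^ d * (x ^ d * T) * Real.exp (-(c₁ / 4) * T ^ 2) := by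
          exact mul_le_mul_of_nonneg_left (hexp _ (by linarith)) (by positivity)
      _ = _ := by rw [hR]; ring

/-! ### The Edgeworth expansion under a decay condition on the characteristic function -/

lemma Finset.sum_Icc_one_eq_sum_range {M : Type*} [AddCommMonoid M] (f : ℕ → M) (r : ℕ) :
    ∑ k ∈ Finset.Icc 1 r, f k = ∑ k ∈ Finset.range r, f (k + 1) := by
  induction r with
  | zero => simp
  | succ r ih => rw [Finset.sum_Icc_succ_top (by omega), ih, Finset.sum_range_succ]

lemma rpow_natCast_div_two (n k : ℕ) : (n : ℝ) ^ ((k : ℝ) / 2) = √(n : ℝ) ^ k := by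
  rw [Real.sqrt_eq_rpow, ← Real.rpow_natCast, ← Real.rpow_mul (by positivity)]
  congr 1; ring

lemma fourierStieltjes_edgeworthSeries_hermiteDual (g : ℕ → Polynomial ℝ) (r n : ℕ) (t : ℝ) :
    fourierStieltjes (edgeworthSeries (fun k => hermiteDual (g (k - 1))) r n) t =
      edgeworthFourier g r (√(n : ℝ))⁻¹ t := by
  rw [fourierStieltjes_edgeworthSeries, gaussFourier_edgeworthDensity,
    Finset.sum_Icc_one_eq_sum_range, edgeworthFourier, mul_add, mul_one, Finset.mul_sum,
    Finset.mul_sum]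
  have he : Complex.exp ((-(t ^ 2 / 2) : ℝ) : ℂ) = Complex.exp (-t ^ 2 / 2) := by
    congr 1; push_cast; ring
  rw [he]
  congr 1
  refine Finset.sum_congr rfl fun k _ => ?_
  rw [gaussFourier_gaussDeriv_hermiteDual, rpow_natCast_div_two, ← inv_pow]
  push_cast
  ring

lemma exists_abs_gaussian_mul_edgeworthDensity_le (P : ℕ → Polynomial ℝ) (r : ℕ) :
    ∃ m : ℝ, 0 < m ∧ ∀ n : ℕ, 1 ≤ n → ∀ z : ℝ,
      |gaussianPDFReal 0 1 z * (edgeworthDensity P r n).eval z| ≤ m := by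
  have hb : ∀ Q : Polynomial ℝ, ∃ C : ℝ, 0 < C ∧ ∀ z, |gaussianPDFReal 0 1 z * Q.eval z| ≤ C := by
    intro Q
    obtain ⟨C, hC, h⟩ := abs_gaussian_mul_eval_le Q
    refine ⟨C, hC, fun z => (h z).trans (mul_le_of_le_one_right hC.le (Real.exp_le_one_iff.2 ?_))⟩
    nlinarith [sq_nonneg z]
  choose C hC hb using hb
  refine ⟨C 1 + ∑ k ∈ Finset.Icc 1 r, C (gaussDeriv (P k)),
    add_pos_of_pos_of_nonneg (hC _) (Finset.sum_nonneg fun k _ => (hC _).le), fun n hn z => ?_⟩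
  rw [edgeworthDensity, Polynomial.eval_add, Polynomial.eval_finsetSum, mul_add, Finset.mul_sum]
  refine (abs_add_le _ _).trans (add_le_add (hb 1 z) ((Finset.abs_sum_le_sum_abs _ _).trans ?_))
  refine Finset.sum_le_sum fun k _ => ?_
  rw [Polynomial.eval_mul, Polynomial.eval_C, mul_left_comm, abs_mul]
  have h1 : (1 : ℝ) ≤ (n : ℝ) ^ ((k : ℝ) / 2) :=
    Real.one_le_rpow (by exact_mod_cast hn) (by positivity)
  rw [abs_of_nonneg (by positivity)]
  exact (mul_le_of_le_one_left (abs_nonneg _) (inv_le_one_of_one_le₀ h1)).trans (hb _ z)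

lemma tendsto_rpow_mul_exp_neg_mul_rpow (a : ℝ) {b κ : ℝ} (hb : 0 < b) (hκ : 0 < κ) :
    Tendsto (fun n : ℕ => (n : ℝ) ^ a * Real.exp (-b * (n : ℝ) ^ κ)) atTop (𝓝 0) := by
  have h := (tendsto_rpow_mul_exp_neg_mul_atTop_nhds_zero (a / κ) b hb).comp
    ((tendsto_rpow_atTop hκ).comp (tendsto_natCast_atTop_atTop (R := ℝ)))
  refine h.congr fun n => ?_
  simp only [Function.comp_apply]
  rw [← Real.rpow_mul (by positivity), mul_div_cancel₀ _ hκ.ne']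

/-- If `t` is beyond `σ √n`, the decay condition makes the characteristic function of the
normalised sum smaller than any power of `n`, as long as `t ≤ n ^ R` with `(R - 1/2) γ < 1`. -/
lemma norm_pow_le_of_decay {φ : ℝ → ℂ} {K γ σ R : ℝ} (hK : 0 < K) (hγ : 0 ≤ γ) (hσ : 0 < σ)
    (hφ : ∀ s : ℝ, 1 < |s| → ‖φ s‖ ≤ 1 - K / |s| ^ γ) {n : ℕ} (hn : 1 ≤ n) {t : ℝ}
    (h1 : σ * √(n : ℝ) < t) (h2 : t ≤ (n : ℝ) ^ R) :
    ‖φ (t / (σ * √(n : ℝ))) ^ n‖ ≤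
      Real.exp (-(K * σ ^ γ) * (n : ℝ) ^ (1 - (R - 1 / 2) * γ)) := by
  have hn0 : (0 : ℝ) < n := by positivity
  have hσn : 0 < σ * √(n : ℝ) := by positivity
  set s := t / (σ * √(n : ℝ)) with hs
  have hs1 : 1 < s := (one_lt_div hσn).2 h1
  have hs0 : 0 < s := by linarith
  have hsle : s ≤ (n : ℝ) ^ (R - 1 / 2) / σ := by
    rw [Real.rpow_sub hn0, ← Real.sqrt_eq_rpow, div_div, hs, mul_comm σ]
    gcongr
  have hb := hφ s (by rwa [abs_of_pos hs0])
  rw [abs_of_pos hs0] at hb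
  have h3 : ‖φ s‖ ≤ Real.exp (-(K / s ^ γ)) := by
    have := Real.add_one_le_exp (-(K / s ^ γ)); linarith
  rw [norm_pow]
  calc ‖φ s‖ ^ n ≤ Real.exp (-(K / s ^ γ)) ^ n := by gcongr
    _ = Real.exp (-(n * (K / s ^ γ))) := by rw [← Real.exp_nat_mul]; congr 1; ring
    _ ≤ Real.exp (-(n * (K / ((n : ℝ) ^ (R - 1 / 2) / σ) ^ γ))) := by gcongr
    _ = _ := by
      congr 1
      rw [Real.div_rpow (by positivity) hσ.le, ← Real.rpow_mul hn0.le, Real.rpow_sub hn0,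
        Real.rpow_one]
      field_simp

lemma charFun_normalized_sum {Ω : Type*} [MeasurableSpace Ω] {μ : Measure Ω}
    [IsProbabilityMeasure μ] {X : ℕ → Ω → ℝ} (hindep : iIndepFun X μ)
    (hident : ∀ i, IdentDistrib (X i) (X 0) μ μ) (σ : ℝ) (n : ℕ) (t : ℝ) :
    charFun (μ.map fun ω => (∑ i ∈ Finset.range n, X i ω) / (σ * √(n : ℝ))) t =
      charFun (μ.map (X 0)) (t / (σ * √(n : ℝ))) ^ n := by
  have h1 : (fun ω => (∑ i ∈ Finset.range n, X i ω) / (σ * √(n : ℝ))) =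
      fun ω => σ⁻¹ * ((√(n : ℝ))⁻¹ * ∑ i ∈ Finset.range n, X i ω) := by
    ext ω; rw [div_eq_mul_inv, mul_inv]; ring
  have hm : AEMeasurable (fun ω => (√(n : ℝ))⁻¹ * ∑ i ∈ Finset.range n, X i ω) μ :=
    (Finset.aemeasurable_fun_sum _ fun i _ => (hident i).aemeasurable_fst).const_mul _
  rw [h1, charFun_map_mul_comp hm, charFun_inv_sqrt_mul_sum hindep hident]
  congr 2
  rw [div_eq_mul_inv, mul_inv]; ring

/-- The Edgeworth expansion for nondegenerate laws whose characteristic function satisfies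
`|φ(s)| ≤ 1 - K / |s|^γ` at infinity with `γ ≥ 0`. The smoothing inequality is applied with
`T = n ^ R'` for some `R'` slightly larger than `R`. For `t ≤ σ √n` the integrand is `O(n^{-d/2})`
with a Gaussian weight; for larger `t` the characteristic function decays like a stretched
exponential in `n`, and the Fourier transform of the Edgeworth series is negligible. -/
theorem edgeworthApprox_of_norm_charFun_le {Ω : Type*} [MeasurableSpace Ω] {μ : Measure Ω}
    [IsProbabilityMeasure μ] {X : ℕ → Ω → ℝ} (hindep : iIndepFun X μ)
    (hident : ∀ i, IdentDistrib (X i) (X 0) μ μ)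
    (hmean : ∫ ω, X 0 ω ∂μ = 0) {σ : ℝ} (hσ : 0 < σ) (hvar : variance (X 0) μ = σ ^ 2)
    {d : ℕ} (hd : 1 ≤ d) (hmem : MemLp (X 0) ((d + 2 : ℕ) : ENNReal) μ) {K γ : ℝ} (hK : 0 < K)
    (hγ : 0 ≤ γ) (hφ : ∀ s : ℝ, 1 < |s| → ‖charFun (μ.map (X 0)) s‖ ≤ 1 - K / |s| ^ γ)
    {R : ℝ} (hR : R < (d : ℝ) / 2) (hRγ : (R - 1 / 2) * γ < 1) :
    EdgeworthApprox μ X σ (d - 1) R := by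
  have hX : AEMeasurable (X 0) μ := (hident 0).aemeasurable_fst
  have : IsProbabilityMeasure (μ.map (X 0)) := Measure.isProbabilityMeasure_map hX
  set φ := charFun (μ.map (X 0)) with hφdef
  have hY : AEMeasurable (fun ω => σ⁻¹ * X 0 ω) μ := hX.const_mul _
  set ρ := μ.map (fun ω => σ⁻¹ * X 0 ω) with hρ
  have : IsProbabilityMeasure ρ := Measure.isProbabilityMeasure_map hY
  have hψ : ∀ u, charFun ρ u = φ (σ⁻¹ * u) := fun u => charFun_map_mul_comp hX σ⁻¹ u
  have hmemρ : MemLp id ((d + 2 : ℕ) : ENNReal) ρ :=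
    (memLp_map_measure_iff aestronglyMeasurable_id hY).2 (hmem.const_mul σ⁻¹)
  have hρ1 : ∫ x, x ∂ρ = 0 := by
    rw [hρ, integral_map (f := fun x : ℝ => x) hY aestronglyMeasurable_id, integral_const_mul,
      hmean, mul_zero]
  have hρ2 : ∫ x, x ^ 2 ∂ρ = 1 := by
    rw [hρ, integral_map hY (Continuous.aestronglyMeasurable (by fun_prop))]
    rw [variance_of_integral_eq_zero hX hmean] at hvar
    simp only [mul_pow]
    rw [integral_const_mul, hvar]
    field_simp
  obtain ⟨V, M, hM, hV⟩ := exists_charFun_mul_exp_expansion hmemρ (by omega) hρ1 hρ2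
  obtain ⟨c, hc, hexp⟩ := exists_norm_charFun_le_exp hK hγ hφ
  obtain ⟨g, C, c', hC, hc', happrox⟩ := exists_edgeworthFourier_approx (ψ := charFun ρ) hd hM hV
    (c := c / σ ^ 2) (by positivity) hσ (fun u hu => by
      rw [hψ]
      refine (hexp _ ?_).trans_eq ?_
      · rw [abs_mul, abs_of_pos (inv_pos.2 hσ), inv_mul_le_iff₀ hσ, mul_one]; exact hu
      · congr 1; field_simp)
  set P : ℕ → Polynomial ℝ := fun k => hermiteDual (g (k - 1)) with hP
  have hφψ : ∀ (n : ℕ) (t : ℝ), φ (t / (σ * √(n : ℝ))) = charFun ρ (t * (√(n : ℝ))⁻¹) :=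
    fun n t => by rw [hψ]; congr 1; rw [div_eq_mul_inv, mul_inv]; ring
  have hx0 : Tendsto (fun n : ℕ => (√(n : ℝ))⁻¹) atTop (𝓝 0) :=
    tendsto_inv_atTop_zero.comp (Real.tendsto_sqrt_atTop.comp tendsto_natCast_atTop_atTop)
  have hPE : IsEdgeworthPolynomials φ σ (d - 1) P := by
    intro t
    have hlim : Tendsto (fun n : ℕ => (√(n : ℝ))⁻¹ * (C * |t|)) atTop (𝓝 0) := by
      simpa using hx0.mul_const (C * |t|)
    have hsmall : ∀ᶠ n : ℕ in atTop, |t * (√(n : ℝ))⁻¹| ≤ σ := by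
      have := (hx0.const_mul t).abs
      rw [mul_zero, abs_zero] at this
      exact this.eventually_le_const hσ
    refine squeeze_zero_norm' ?_ hlim
    filter_upwards [hsmall, eventually_ge_atTop 2] with n hn hn2
    have hs : 0 < √(n : ℝ) := Real.sqrt_pos.2 (by positivity)
    rw [hφψ, fourierStieltjes_edgeworthSeries_hermiteDual, norm_mul, Complex.norm_real,
      Real.norm_of_nonneg (by positivity), rpow_natCast_div_two]
    have h1 : Real.exp (-c' * t ^ 2) ≤ 1 := Real.exp_le_one_iff.2 (by nlinarith [sq_nonneg t])
    calc _ ≤ √(n : ℝ) ^ (d - 1) * (C * (√(n : ℝ))⁻¹ ^ d * |t| * Real.exp (-c' * t ^ 2)) := by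
          gcongr; exact happrox n hn2 t hn
      _ ≤ √(n : ℝ) ^ (d - 1) * (C * (√(n : ℝ))⁻¹ ^ d * |t| * 1) := by gcongr
      _ = (√(n : ℝ) * (√(n : ℝ))⁻¹) ^ (d - 1) * ((√(n : ℝ))⁻¹ * (C * |t|)) := by
          have : (√(n : ℝ))⁻¹ ^ d = (√(n : ℝ))⁻¹ * (√(n : ℝ))⁻¹ ^ (d - 1) := by
            rw [← pow_succ']; congr 1; omega
          rw [this, mul_pow]; ring
      _ = _ := by rw [mul_inv_cancel₀ hs.ne', one_pow, one_mul]
  refine ⟨⟨P, hPE⟩, fun Q hQ => ?_⟩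
  -- every requirement on `R` is open and holds for `max R 0` too, so there is room above it
  obtain ⟨R', hR'0, hR'd, hR'γ⟩ : ∃ R', max R 0 < R' ∧ R' < (d : ℝ) / 2 ∧ (R' - 1 / 2) * γ < 1 := by
    have h1 : (max R 0 - 1 / 2) * γ < 1 := by
      rcases max_cases R 0 with ⟨h, -⟩ | ⟨h, -⟩ <;> rw [h]
      · exact hRγ
      · linarith
    have h2 : Tendsto (fun r : ℝ => (r - 1 / 2) * γ) (𝓝[>] (max R 0))
        (𝓝 ((max R 0 - 1 / 2) * γ)) :=
      (Continuous.tendsto (by fun_prop) _).mono_left nhdsWithin_le_nhds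
    have h3 : max R 0 < (d : ℝ) / 2 := max_lt hR (by positivity)
    obtain ⟨r, h4, h5⟩ := ((h2.eventually_lt_const h1).and (Ioo_mem_nhdsGT h3)).exists
    exact ⟨r, h5.1, h5.2, h4⟩
  have hRR' : R < R' := (le_max_left _ _).trans_lt hR'0
  set κ := 1 - (R' - 1 / 2) * γ with hκ
  have hκ0 : 0 < κ := by linarith
  obtain ⟨CS, hCS, hsmooth⟩ := exists_esseen_smoothing
  obtain ⟨m, hm, hmb⟩ := exists_abs_gaussian_mul_edgeworthDensity_le P (d - 1)
  obtain ⟨CE, hCE, hEb⟩ := exists_norm_edgeworthFourier_le g (d - 1)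
  obtain ⟨CD, hCD, hD⟩ := pow_le_const_mul_exp_sq (d - 1) (c := 1 / 8) (by norm_num)
  -- the integrand in the smoothing inequality is at most `n^{-d/2} w(t) + ε n` on `(0, n ^ R']`
  set w : ℝ → ℝ := fun t =>
    C * Real.exp (-c' * t ^ 2) + CE * CD / σ ^ d * Real.exp (-(1 / 8) * t ^ 2) with hw
  have hwi : Integrable w := ((integrable_exp_neg_mul_sq hc').const_mul _).add
    ((integrable_exp_neg_mul_sq (by norm_num)).const_mul _)
  have hw0 : ∀ t, 0 ≤ w t := fun t => by positivity
  set ε : ℕ → ℝ := fun n => σ⁻¹ * Real.exp (-(K * σ ^ γ) * (n : ℝ) ^ κ) with hε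
  have hmain : ∀ n : ℕ, 2 ≤ n → ∀ z : ℝ,
      |μ.real {ω | (∑ i ∈ Finset.range n, X i ω) / (σ * √(n : ℝ)) ≤ z} -
        edgeworthSeries P (d - 1) n z| ≤
      CS * (((√(n : ℝ))⁻¹ ^ d * ∫ t, w t) + (n : ℝ) ^ R' * ε n + m / (n : ℝ) ^ R') := by
    intro n hn z
    have hn0 : (0 : ℝ) < n := by positivity
    have hS : AEMeasurable (fun ω => (∑ i ∈ Finset.range n, X i ω) / (σ * √(n : ℝ))) μ :=
      (Finset.aemeasurable_fun_sum _ fun i _ => (hident i).aemeasurable_fst).div_const _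
    have hprob := Measure.isProbabilityMeasure_map hS
    have hT : 0 < (n : ℝ) ^ R' := by positivity
    set x := (√(n : ℝ))⁻¹ with hx
    have hx0 : 0 < x := by positivity
    have hx1 : x ≤ 1 := inv_le_one_of_one_le₀
      (Real.one_le_sqrt.2 (by exact_mod_cast (by omega : 1 ≤ n)))
    have hwx : IntervalIntegrable (fun t => x ^ d * w t) volume 0 ((n : ℝ) ^ R') :=
      (hwi.const_mul _).intervalIntegrable
    have h1 := hsmooth (μ.map fun ω => (∑ i ∈ Finset.range n, X i ω) / (σ * √(n : ℝ)))
      (fun y => gaussianPDFReal 0 1 y * (edgeworthDensity P (d - 1) n).eval y)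
      (integrable_gaussian_mul_eval _) m (hmb n (by omega)) _ hT (fun t => x ^ d * w t + ε n)
      (hwx.add intervalIntegrable_const) (fun t ht => ?_) z
    · rw [← edgeworthSeries_eq_integral, map_measureReal_apply_of_aemeasurable hS measurableSet_Iic]
        at h1
      refine h1.trans ?_
      gcongr
      rw [intervalIntegral.integral_add hwx intervalIntegrable_const,
        intervalIntegral.integral_const_mul, intervalIntegral.integral_const, sub_zero, smul_eq_mul]
      gcongr
      rw [intervalIntegral.integral_of_le hT.le]
      exact setIntegral_le_integral hwi (Eventually.of_forall hw0)
    · rw [charFun_normalized_sum hindep hident]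
      change ‖φ _ ^ n - gaussFourier (edgeworthDensity P (d - 1) n) t‖ ≤ _
      rw [← fourierStieltjes_edgeworthSeries, fourierStieltjes_edgeworthSeries_hermiteDual, ← hx]
      have hε0 : 0 ≤ ε n := by positivity
      have ht0 : 0 < t := ht.1
      rcases le_or_gt t (σ * √(n : ℝ)) with hle | hgt
      · rw [hφψ, ← hx]
        refine (happrox n hn t ?_).trans ?_
        · rw [abs_of_pos (by positivity), ← div_eq_mul_inv,
            div_le_iff₀ (Real.sqrt_pos.2 hn0)]
          exact hle
        · rw [abs_of_pos ht0, ← hx]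
          calc C * x ^ d * t * Real.exp (-c' * t ^ 2)
              = t * (x ^ d * (C * Real.exp (-c' * t ^ 2) + 0) + 0) := by ring
            _ ≤ t * (x ^ d * w t + ε n) := by
              simp only [hw]
              gcongr
              positivity
      · have h2 := norm_pow_le_of_decay hK hγ hσ hφ (by omega) hgt ht.2
        have hsn : 0 < σ * √(n : ℝ) := by positivity
        -- beyond `σ √n` a factor `(t x / σ) ^ d ≥ 1` produces the missing power of `n`
        have htx : 1 ≤ t * x / σ := by
          have : t * x / σ = t / (σ * √(n : ℝ)) := by rw [hx]; field_simp
          rw [this]; exact ((one_lt_div hsn).2 hgt).le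
        have htσ : 1 ≤ t * σ⁻¹ := by
          refine htx.trans ?_
          rw [div_eq_mul_inv]
          gcongr
          exact mul_le_of_le_one_right ht0.le hx1
        have h3 : ‖φ (t / (σ * √(n : ℝ))) ^ n‖ ≤ t * ε n := by
          refine h2.trans ?_
          simp only [hε]
          rw [← mul_assoc]
          exact le_mul_of_one_le_left (Real.exp_pos _).le htσ
        have h4 : ‖edgeworthFourier g (d - 1) x t‖ ≤ t * (x ^ d * w t) := by
          have htd : t ^ d = t * t ^ (d - 1) := by rw [← pow_succ']; congr 1; omega
          calc _ ≤ CE * Real.exp (-(1 / 4) * t ^ 2) * 1 := by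
                rw [mul_one]; exact hEb x t hx0.le hx1
            _ ≤ CE * Real.exp (-(1 / 4) * t ^ 2) * (t * x / σ) ^ d := by
                gcongr; exact one_le_pow₀ htx
            _ = CE / σ ^ d * (t * x ^ d) * (t ^ (d - 1) * Real.exp (-(1 / 4) * t ^ 2)) := by
                rw [div_pow, mul_pow, htd]; ring
            _ ≤ CE / σ ^ d * (t * x ^ d) *
                (CD * Real.exp (1 / 8 * t ^ 2) * Real.exp (-(1 / 4) * t ^ 2)) := by
                gcongr; exact hD t ht0.le
            _ = t * (x ^ d * (0 + CE * CD / σ ^ d * Real.exp (-(1 / 8) * t ^ 2))) := by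
                rw [mul_assoc CD, ← Real.exp_add,
                  show 1 / 8 * t ^ 2 + -(1 / 4) * t ^ 2 = -(1 / 8) * t ^ 2 by ring]
                ring
            _ ≤ _ := by
                simp only [hw]
                gcongr
                positivity
        refine (norm_sub_le _ _).trans ?_
        rw [mul_add]
        linarith
  have hlim : Tendsto (fun n : ℕ => (n : ℝ) ^ R *
      (CS * (((√(n : ℝ))⁻¹ ^ d * ∫ t, w t) + (n : ℝ) ^ R' * ε n + m / (n : ℝ) ^ R')))
      atTop (𝓝 0) := by
    have hneg : ∀ {a : ℝ}, a < 0 → Tendsto (fun n : ℕ => (n : ℝ) ^ a) atTop (𝓝 0) := by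
      intro a ha
      have := (tendsto_rpow_neg_atTop (neg_pos.2 ha)).comp (tendsto_natCast_atTop_atTop (R := ℝ))
      rw [neg_neg] at this
      exact this
    have h1 := (hneg (show R - (d : ℝ) / 2 < 0 by linarith)).mul_const (CS * ∫ t, w t)
    have h2 := (tendsto_rpow_mul_exp_neg_mul_rpow (R + R') (b := K * σ ^ γ) (by positivity)
      hκ0).mul_const (CS * σ⁻¹)
    have h3 := (hneg (show R - R' < 0 by linarith)).mul_const (CS * m)
    have h4 := (h1.add h2).add h3
    simp only [zero_mul, add_zero] at h4
    refine h4.congr' ?_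
    filter_upwards [eventually_ge_atTop 1] with n hn
    have hn0 : (0 : ℝ) < n := by positivity
    rw [Real.rpow_sub hn0 R ((d : ℝ) / 2), Real.rpow_sub hn0 R R', Real.rpow_add hn0,
      rpow_natCast_div_two, inv_pow]
    simp only [hε]
    ring
  rw [Metric.tendstoUniformly_iff]
  intro e he
  filter_upwards [hlim.eventually_lt_const he, eventually_ge_atTop 2] with n hn hn2 z
  rw [dist_zero_left, norm_mul, Real.norm_of_nonneg (by positivity),
    edgeworthSeries_congr (hQ.unique hPE)]
  refine lt_of_le_of_lt ?_ hn
  gcongr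
  exact hmain n hn2 z

/-! ### Laws of finite support and simultaneous Diophantine approximation -/

/-- A degenerate law has a characteristic function of constant modulus one. -/
lemma sigma_pos_of_norm_charFun_le {Ω : Type*} [MeasurableSpace Ω] {μ : Measure Ω}
    [IsProbabilityMeasure μ] {X : Ω → ℝ} (hX : MemLp X 2 μ) (hmean : ∫ ω, X ω ∂μ = 0) {σ : ℝ}
    (hσ : 0 ≤ σ) (hvar : variance X μ = σ ^ 2) {K γ : ℝ} (hK : 0 < K)
    (hφ : ∀ s : ℝ, 1 < |s| → ‖charFun (μ.map X) s‖ ≤ 1 - K / |s| ^ γ) : 0 < σ := by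
  refine lt_of_le_of_ne hσ fun h => ?_
  rw [← h, zero_pow two_ne_zero] at hvar
  have h1 := ae_eq_integral_of_variance_eq_zero hX hvar
  have h2 : μ.map X = Measure.dirac 0 := by
    rw [Measure.map_congr h1, hmean, Measure.map_const]; simp
  have h3 := hφ 2 (by norm_num)
  rw [h2, charFun_dirac] at h3
  have : 0 < K / |(2 : ℝ)| ^ γ := by positivity
  simp at h3 this
  linarith

lemma two_div_pi_sq_mul_infDist_sq_le (x : ℝ) :
    2 / Real.pi ^ 2 * Metric.infDist x (Set.range fun m : ℤ => 2 * Real.pi * m) ^ 2 ≤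
      1 - Real.cos x := by
  have hpi := Real.pi_pos
  set m := round (x / (2 * Real.pi)) with hm
  set y := x - m * (2 * Real.pi) with hy
  have hy1 : |y| ≤ Real.pi := by
    have h1 := abs_sub_round (x / (2 * Real.pi))
    have h2 : y = (x / (2 * Real.pi) - m) * (2 * Real.pi) := by rw [hy]; field_simp
    rw [h2, abs_mul, abs_of_pos (show 0 < 2 * Real.pi by positivity)]
    nlinarith
  have h3 : Metric.infDist x (Set.range fun m : ℤ => 2 * Real.pi * m) ≤ |y| := by
    refine (Metric.infDist_le_dist_of_mem (s := Set.range fun m : ℤ => 2 * Real.pi * m)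
          ⟨m, rfl⟩).trans_eq ?_
    rw [Real.dist_eq, hy]; congr 1; ring
  have h4 := Real.cos_le_one_sub_mul_cos_sq hy1
  rw [hy, Real.cos_sub_int_mul_two_pi, ← hy] at h4
  have h5 : Metric.infDist x (Set.range fun m : ℤ => 2 * Real.pi * m) ^ 2 ≤ y ^ 2 := by
    rw [← sq_abs y]; gcongr; exact Metric.infDist_nonneg
  calc _ ≤ 2 / Real.pi ^ 2 * y ^ 2 := by gcongr
    _ ≤ _ := by linarith

lemma one_sub_cos_sub_le (x y : ℝ) :
    1 - Real.cos (x - y) ≤ 2 * (1 - Real.cos x) + 2 * (1 - Real.cos y) := by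
  rw [Real.cos_sub]
  nlinarith [Real.sin_sq_add_cos_sq x, Real.sin_sq_add_cos_sq y,
    sq_nonneg (Real.cos x + Real.cos y - 2), sq_nonneg (Real.sin x + Real.sin y)]

lemma integral_sum_smul_dirac {ι : Type*} [Fintype ι] (a p : ι → ℝ) (hp : ∀ j, 0 < p j)
    (f : ℝ → ℝ) :
    ∫ x, f x ∂(∑ j, ENNReal.ofReal (p j) • Measure.dirac (a j)) = ∑ j, p j * f (a j) := by
  rw [integral_finsetSum_measure fun j _ =>
    (integrable_dirac (by simp)).smul_measure ENNReal.ofReal_ne_top]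
  refine Finset.sum_congr rfl fun j _ => ?_
  rw [integral_smul_measure, integral_dirac, ENNReal.toReal_ofReal (hp j).le, smul_eq_mul]

/-- Since the values `a j` and `a 0` are both taken, `|φ(s)|` can be close to `1` only if the
phases `a j s` and `a 0 s` almost agree. -/
lemma exists_norm_charFun_le_dioDist {d : ℕ} (hd : 1 ≤ d) {ρ : Measure ℝ} [IsProbabilityMeasure ρ]
    (a p : Fin (d + 1) → ℝ) (hp : ∀ j, 0 < p j)
    (hρ : ρ = ∑ j, ENNReal.ofReal (p j) • Measure.dirac (a j)) :
    ∃ c : ℝ, 0 < c ∧ ∀ s : ℝ, ‖charFun ρ s‖ ≤ 1 - c * dioDist a s ^ 2 := by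
  obtain ⟨i, hi⟩ := Finite.exists_min p
  have : Nonempty (Fin d) := ⟨⟨0, hd⟩⟩
  refine ⟨p i / Real.pi ^ 2, by have := hp i; have := Real.pi_pos; positivity, fun s => ?_⟩
  obtain ⟨j, hj⟩ := exists_eq_ciSup_of_finite (f := fun j : Fin d =>
    Metric.infDist ((a j.succ - a 0) * s) (Set.range fun m : ℤ => 2 * Real.pi * m))
  have h1 : dioDist a s =
      Metric.infDist ((a j.succ - a 0) * s) (Set.range fun m : ℤ => 2 * Real.pi * m) := hj.symm
  set α := (charFun ρ s).arg
  have h2 : ‖charFun ρ s‖ = ∑ j, p j * Real.cos (s * a j - α) := by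
    rw [norm_charFun_eq_integral_cos,
      ← integral_sum_smul_dirac a p hp (fun x => Real.cos (s * x - α)), ← hρ]
  have h3 : 1 = ∑ j, p j := by
    have := integral_sum_smul_dirac a p hp fun _ => 1
    rw [← hρ] at this
    simpa using this
  have h4 : 1 - ‖charFun ρ s‖ = ∑ j, p j * (1 - Real.cos (s * a j - α)) := by
    simp only [mul_sub, mul_one, Finset.sum_sub_distrib]
    rw [h2, ← h3]
  have hnn : ∀ j, 0 ≤ 1 - Real.cos (s * a j - α) := fun j => by
    linarith [Real.cos_le_one (s * a j - α)]
  have h5 : p 0 * (1 - Real.cos (s * a 0 - α)) + p j.succ * (1 - Real.cos (s * a j.succ - α)) ≤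
      1 - ‖charFun ρ s‖ := by
    rw [h4, Fin.sum_univ_succ]
    gcongr
    exact Finset.single_le_sum (f := fun j : Fin d => p j.succ * (1 - Real.cos (s * a j.succ - α)))
      (fun k _ => mul_nonneg (hp _).le (hnn _)) (Finset.mem_univ j)
  have h6 := one_sub_cos_sub_le (s * a j.succ - α) (s * a 0 - α)
  have h7 : s * a j.succ - α - (s * a 0 - α) = (a j.succ - a 0) * s := by ring
  rw [h7] at h6
  have h8 := two_div_pi_sq_mul_infDist_sq_le ((a j.succ - a 0) * s)
  rw [← h1] at h8
  have h9 : p i * (1 - Real.cos (s * a 0 - α)) ≤ p 0 * (1 - Real.cos (s * a 0 - α)) :=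
    mul_le_mul_of_nonneg_right (hi 0) (hnn 0)
  have h10 : p i * (1 - Real.cos (s * a j.succ - α)) ≤
      p j.succ * (1 - Real.cos (s * a j.succ - α)) :=
    mul_le_mul_of_nonneg_right (hi j.succ) (hnn j.succ)
  have h11 : p i * (2 / Real.pi ^ 2 * dioDist a s ^ 2) ≤ p i *
      (2 * (1 - Real.cos (s * a j.succ - α)) + 2 * (1 - Real.cos (s * a 0 - α))) :=
    mul_le_mul_of_nonneg_left (h8.trans h6) (hp i).le
  have h12 : p i / Real.pi ^ 2 * dioDist a s ^ 2 =
      p i * (2 / Real.pi ^ 2 * dioDist a s ^ 2) / 2 := by ring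
  rw [h12]
  linarith

/-- Dirichlet's theorem on simultaneous approximation, by the pigeonhole principle. -/
lemma exists_nat_abs_mul_sub_le {ι : Type*} [Fintype ι] (θ : ι → ℝ) {N : ℕ} (hN : 1 ≤ N) :
    ∃ k : ℕ, 1 ≤ k ∧ k ≤ N ^ Fintype.card ι ∧ ∀ i, ∃ m : ℤ, |k * θ i - m| ≤ 1 / N := by
  classical
  have hN0 : (0 : ℝ) < N := by positivity
  have hfl : ∀ x : ℝ, ⌊Int.fract x * N⌋₊ < N := fun x => by
    rw [Nat.floor_lt (by have := Int.fract_nonneg x; positivity)]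
    exact mul_lt_of_lt_one_left hN0 (Int.fract_lt_one x)
  set F : ℕ → ι → Fin N := fun k i => ⟨⌊Int.fract (k * θ i) * N⌋₊, hfl _⟩ with hF
  obtain ⟨k, hk, l, hl, hkl, heq⟩ := Finset.exists_ne_map_eq_of_card_lt_of_maps_to
    (s := Finset.range (N ^ Fintype.card ι + 1)) (t := (Finset.univ : Finset (ι → Fin N)))
    (f := F) (by simp) (fun _ _ => by simp)
  have main : ∀ k l : ℕ, l < N ^ Fintype.card ι + 1 → k < l → F k = F l →
      ∃ k : ℕ, 1 ≤ k ∧ k ≤ N ^ Fintype.card ι ∧ ∀ i, ∃ m : ℤ, |k * θ i - m| ≤ 1 / N := by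
    intro k l hl hkl heq
    refine ⟨l - k, by omega, by omega, fun i => ⟨⌊l * θ i⌋ - ⌊k * θ i⌋, ?_⟩⟩
    have h1 : ⌊Int.fract (k * θ i) * N⌋₊ = ⌊Int.fract (l * θ i) * N⌋₊ :=
      congrArg Fin.val (congrFun heq i)
    have h2 : ∀ x : ℝ, (⌊Int.fract x * N⌋₊ : ℝ) ≤ Int.fract x * N := fun x =>
      Nat.floor_le (by have := Int.fract_nonneg x; positivity)
    have h3 : ∀ x : ℝ, Int.fract x * N < ⌊Int.fract x * N⌋₊ + 1 := fun x => Nat.lt_floor_add_one _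
    have a1 := h2 (k * θ i)
    have a2 := h3 (k * θ i)
    have b1 := h2 (l * θ i)
    have b2 := h3 (l * θ i)
    rw [h1] at a1 a2
    have h4 : ((l - k : ℕ) : ℝ) * θ i - ((⌊l * θ i⌋ - ⌊k * θ i⌋ : ℤ) : ℝ) =
        Int.fract (l * θ i) - Int.fract (k * θ i) := by
      rw [Nat.cast_sub hkl.le, ← Int.self_sub_floor, ← Int.self_sub_floor]
      push_cast; ring
    rw [h4, abs_le, ← neg_div, div_le_iff₀ hN0, le_div_iff₀ hN0]
    constructor <;> linarith
  rcases lt_or_gt_of_ne hkl with h | h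
  · exact main k l (Finset.mem_range.1 hl) h heq
  · exact main l k (Finset.mem_range.1 hk) h heq.symm

/-- The `d` differences `a j - a 0` cannot be `β`-Diophantine with `β < 1 / (d - 1)`. The choice of
`s` makes one of the phases a multiple of `2π`, so that the approximation takes place in dimension
`d - 1`. -/
lemma IsDiophantine.one_le_mul {d : ℕ} (hd : 1 ≤ d) {a : Fin (d + 1) → ℝ} {β : ℝ}
    (h : IsDiophantine a β) : 1 ≤ ((d : ℝ) - 1) * β := by
  classical
  obtain ⟨K, hK, h⟩ := h
  have hpi := Real.pi_pos
  have : Nonempty (Fin d) := ⟨⟨0, hd⟩⟩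
  obtain ⟨j₀, hj₀⟩ : ∃ j : Fin d, a j.succ - a 0 ≠ 0 := by
    by_contra hcon
    push Not at hcon
    have h1 : dioDist a 2 = 0 := by
      unfold dioDist
      simp only [hcon, zero_mul]
      rw [ciSup_const]
      exact Metric.infDist_zero_of_mem ⟨0, by simp⟩
    have h2 := h 2 (by norm_num)
    rw [h1] at h2
    have : 0 < K / |(2 : ℝ)| ^ β := by positivity
    linarith
  set b := a j₀.succ - a 0 with hb
  have hb0 : 0 < |b| := abs_pos.2 hj₀
  obtain ⟨q, hq⟩ := exists_nat_gt (|b| / (2 * Real.pi))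
  set c := 2 * Real.pi * q / |b| with hc
  have hc1 : 1 < c := by
    rw [div_lt_iff₀ (by positivity)] at hq
    rw [hc, one_lt_div hb0]; linarith
  have hc0 : 0 < c := by linarith
  -- along the approximations with denominator up to `N ^ (d - 1)`, `d(s)` is at most `2π / N`
  by_contra hcon
  push Not at hcon
  set β' := max β 0 with hβ'
  have hd1 : (0 : ℝ) ≤ (d : ℝ) - 1 := by
    have : (1 : ℝ) ≤ d := by exact_mod_cast hd
    linarith
  have hβ1 : ((d : ℝ) - 1) * β' < 1 := by
    rcases max_cases β 0 with ⟨e, -⟩ | ⟨e, -⟩ <;> rw [hβ', e]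
    · exact hcon
    · simp
  have hβ0 : 0 ≤ β' := le_max_right _ _
  have key : ∀ N : ℕ, 1 ≤ N → (N : ℝ) ^ (1 - ((d : ℝ) - 1) * β') ≤ 2 * Real.pi * c ^ β' / K := by
    intro N hN
    have hN0 : (0 : ℝ) < N := by positivity
    obtain ⟨k, hk1, hkN, hk⟩ := exists_nat_abs_mul_sub_le
      (fun i : {j : Fin d // j ≠ j₀} => q * ((a i.1.succ - a 0) / b)) hN
    have hcard : Fintype.card {j : Fin d // j ≠ j₀} = d - 1 := by
      rw [Fintype.card_subtype_compl]; simp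
    rw [hcard] at hkN
    set s := 2 * Real.pi * q * k / b with hs
    have hsc : |s| = c * k := by
      rw [hs, abs_div, abs_of_nonneg (by positivity), hc]; ring
    have hk1' : (1 : ℝ) ≤ k := by exact_mod_cast hk1
    have hs1 : 1 < |s| := by rw [hsc]; nlinarith
    have hdio : dioDist a s ≤ 2 * Real.pi / N := by
      refine ciSup_le fun j => ?_
      by_cases hj : j = j₀
      · rw [Metric.infDist_zero_of_mem]
        · positivity
        · refine ⟨q * k, ?_⟩
          rw [hj, ← hb, hs]
          push_cast
          field_simp
      · obtain ⟨m, hm⟩ := hk ⟨j, hj⟩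
        refine (Metric.infDist_le_dist_of_mem (s := Set.range fun m : ℤ => 2 * Real.pi * m)
          ⟨m, rfl⟩).trans ?_
        have e1 : (a j.succ - a 0) * s - 2 * Real.pi * m =
            2 * Real.pi * (k * (q * ((a j.succ - a 0) / b)) - m) := by rw [hs]; ring
        rw [Real.dist_eq, e1, abs_mul, abs_of_pos (by positivity), ← mul_one_div (2 * Real.pi)]
        gcongr
    have h1 := (h s hs1).trans hdio
    have h2 : |s| ^ β ≤ c ^ β' * (N : ℝ) ^ (((d : ℝ) - 1) * β') := by
      calc |s| ^ β ≤ |s| ^ β' := Real.rpow_le_rpow_of_exponent_le hs1.le (le_max_left _ _)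
        _ ≤ (c * (N : ℝ) ^ (d - 1)) ^ β' := by
          rw [hsc]
          gcongr
          exact_mod_cast hkN
        _ = _ := by
          rw [Real.mul_rpow hc0.le (by positivity), ← Real.rpow_natCast, ← Real.rpow_mul hN0.le,
            Nat.cast_sub hd, Nat.cast_one]
    have hs0 : 0 < |s| ^ β := Real.rpow_pos_of_pos (by linarith) _
    rw [div_le_div_iff₀ hs0 hN0] at h1
    rw [Real.rpow_sub hN0, Real.rpow_one, div_le_div_iff₀ (by positivity) hK]
    calc N * K = K * N := mul_comm _ _
      _ ≤ 2 * Real.pi * |s| ^ β := h1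
      _ ≤ 2 * Real.pi * (c ^ β' * (N : ℝ) ^ (((d : ℝ) - 1) * β')) := by gcongr
      _ = _ := by ring
  have hlim := (tendsto_rpow_atTop (sub_pos.2 hβ1)).comp (tendsto_natCast_atTop_atTop (R := ℝ))
  obtain ⟨N, h1, h2⟩ := ((hlim.eventually_gt_atTop (2 * Real.pi * c ^ β' / K)).and
    (eventually_ge_atTop 1)).exists
  exact absurd (key N h2) (not_le.2 h1)

lemma memLp_id_sum_smul_dirac {ι : Type*} [Fintype ι] (a p : ι → ℝ) {ρ : Measure ℝ}
    [IsProbabilityMeasure ρ] (hρ : ρ = ∑ j, ENNReal.ofReal (p j) • Measure.dirac (a j))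
    (q : ENNReal) : MemLp id q ρ := by
  refine MemLp.of_bound aestronglyMeasurable_id (∑ j, |a j|) ?_
  rw [hρ, ae_finsetSum_measure_iff]
  intro j _
  refine Measure.ae_smul_measure ?_ _
  rw [ae_dirac_eq]
  exact Finset.single_le_sum (f := fun j => |a j|) (fun k _ => abs_nonneg _) (Finset.mem_univ j)

theorem mainTheorem2 {Ω : Type*} [MeasurableSpace Ω] (μ : Measure Ω) [IsProbabilityMeasure μ]
    (X : ℕ → Ω → ℝ) (hindep : iIndepFun X μ) (hident : ∀ i, IdentDistrib (X i) (X 0) μ μ)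
    (hmean : ∫ ω, X 0 ω ∂μ = 0)
    (σ : ℝ) (hσ : 0 ≤ σ) (hvar : variance (X 0) μ = σ ^ 2)
    (d : ℕ) (hd : 1 ≤ d) :
    (MemLp (X 0) ((d + 2 : ℕ) : ENNReal) μ →
      ∀ K γ : ℝ, 0 < K →
        (∀ s : ℝ, 1 < |s| → ‖charFun (μ.map (X 0)) s‖ ≤ 1 - K / |s| ^ γ) →
        ∀ R : ℝ, R < (d : ℝ) / 2 → (R - 1 / 2) * γ < 1 →
          EdgeworthApprox μ X σ (d - 1) R) ∧
    (∀ a p : Fin (d + 1) → ℝ, (∀ j, 0 < p j) →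
      μ.map (X 0) = ∑ j, ENNReal.ofReal (p j) • Measure.dirac (a j) →
        (∃ c : ℝ, 0 < c ∧ ∀ s : ℝ, ‖charFun (μ.map (X 0)) s‖ ≤ 1 - c * dioDist a s ^ 2) ∧
        ∀ β : ℝ, IsDiophantine a β →
          ∀ R : ℝ, (R - 1 / 2) * β < 1 / 2 →
            EdgeworthApprox μ X σ (d - 1) R) := by
  have hX : AEMeasurable (X 0) μ := (hident 0).aemeasurable_fst
  have part1 : MemLp (X 0) ((d + 2 : ℕ) : ENNReal) μ → ∀ K γ : ℝ, 0 < K →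
      (∀ s : ℝ, 1 < |s| → ‖charFun (μ.map (X 0)) s‖ ≤ 1 - K / |s| ^ γ) →
      ∀ R : ℝ, R < (d : ℝ) / 2 → (R - 1 / 2) * γ < 1 → EdgeworthApprox μ X σ (d - 1) R := by
    intro hmem K γ hK hφ R hR hRγ
    have hmem2 : MemLp (X 0) 2 μ := hmem.mono_exponent (by exact_mod_cast (by omega : 2 ≤ d + 2))
    have hσ0 := sigma_pos_of_norm_charFun_le hmem2 hmean hσ hvar hK hφ
    -- a negative exponent may be replaced by zero
    refine edgeworthApprox_of_norm_charFun_le hindep hident hmean hσ0 hvar hd hmem hK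
      (le_max_right γ 0) (fun s hs => (hφ s hs).trans ?_) hR ?_
    · have hs0 : 0 < |s| := by linarith
      gcongr
      · exact hs.le
      · exact le_max_left _ _
    · rcases max_cases γ 0 with ⟨h, -⟩ | ⟨h, -⟩ <;> rw [h]
      · exact hRγ
      · simp
  refine ⟨part1, fun a p hp hmap => ?_⟩
  have : IsProbabilityMeasure (μ.map (X 0)) := Measure.isProbabilityMeasure_map hX
  obtain ⟨c, hc, hbound⟩ := exists_norm_charFun_le_dioDist hd a p hp hmap
  refine ⟨⟨c, hc, hbound⟩, fun β hβ R hR => ?_⟩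
  have hβd := hβ.one_le_mul hd
  obtain ⟨K, hK, hdio⟩ := hβ
  refine part1 ((memLp_map_measure_iff aestronglyMeasurable_id hX).1
    (memLp_id_sum_smul_dirac a p hmap _)) (c * K ^ 2) (2 * β) (by positivity) (fun s hs => ?_) R ?_
    (by linarith)
  · refine (hbound s).trans ?_
    have hs0 : 0 < |s| := by linarith
    have h1 : c * K ^ 2 / |s| ^ (2 * β) = c * (K / |s| ^ β) ^ 2 := by
      rw [mul_comm 2 β, Real.rpow_mul hs0.le, Real.rpow_ofNat]; ring
    have h2 : K / |s| ^ β ≤ dioDist a s := hdio s hs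
    rw [h1]
    gcongr
  -- `(d - 1) β ≥ 1` turns the hypothesis on `R` into `R < d / 2`
  · have hd1 : (0 : ℝ) ≤ (d : ℝ) - 1 := by
      have : (1 : ℝ) ≤ d := by exact_mod_cast hd
      linarith
    have hβ0 : 0 < β := by
      by_contra hneg
      nlinarith [mul_nonneg hd1 (neg_nonneg.2 (not_lt.1 hneg))]
    by_contra hRd
    nlinarith
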